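/- For $N\ge 0$ let $B_N$ be the classical Artin braid group on $N$ strands, with generators $\sigma_1,\dots,\sigma_{N-1}$ and relations $\sigma_k\sigma_l=\sigma_l\sigma_k$ for $|k-l|\ge 2$ and $\sigma_k\sigma_{k+1}\sigma_k=\sigma_{k+1}\sigma_k\sigma_{k+1}$, and let $P_N\le B_N$ be the pure braid group, i.e. the kernel of $B_N\to S_N$. For $1\le i<j\le N$ put $$a_{ij}=\sigma_{j-1}\cdots\sigma_{i+1}\,\sigma_i^2\,\sigma_{i+1}^{-1}\cdots\sigma_{j-1}^{-1}\in P_N .$$ For $m,n\ge 0$ let $B_{m,n}\le B_{m+n}$ be the subgroup of all braids that become the identity braid on the first $m$ strands when the last $n$ strands are removed, and let $P_{m,n}=B_{m,n}\cap P_{m+n}$, the group of pure braids on $m+n$ strands with no pure braiding among the first $m$ strands. **Theorem.** (a) The group $P_{m,n}$ is generated by the elements $a_{ij}$ with $1\le i<j\le m+n$ and $j\ge m+1$, and on these generators it is presented by the following relations, where all the generators that occur have second index at least $m+1$: $$\begin{array}{lll} (P_1) & a_{ij}^{-1}a_{rs}a_{ij}=a_{rs} & \text{if } i<j<r<s \text{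 or } r<i<j<s,\\ (P_2) & a_{ij}^{-1}a_{js}a_{ij}=a_{is}a_{js}a_{is}^{-1} & \text{if } i<j<s,\\ (P_3) & a_{ij}^{-1}a_{is}a_{ij}=a_{is}a_{js}a_{is}a_{js}^{-1}a_{is}^{-1} & \text{if } i<j<s,\\ (P_4) & a_{ij}^{-1}a_{rs}a_{ij}=a_{is}a_{js}a_{is}^{-1}a_{js}^{-1}a_{rs}a_{js}a_{is}a_{js}^{-1}a_{is}^{-1} & \text{if } i<r<j<s. \end{array}$$ (b) (Artin combing) $P_{m,n}$ is an iterated semidirect product $F_{m+n-1}\rtimes\cdots\rtimes F_{m+1}\rtimes F_m$ of free groups. More precisely, $P_{m,0}$ is trivial and, for every $0\le k<n$, $$P_{m,k+1}=F_{m+k}\rtimes P_{m,k},$$ where $F_{m+k}$ is the free group of rank $m+k$ with free basis $a_{1,m+k+1},\dots,a_{m+k,m+k+1}$, where $P_{m,k}$ is embedded in $P_{m,k+1}$ by adding a trivial last strand, and where $P_{m,k}$ acts on $F_{m+k}$ by conjugation. -/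

import Mathlib

namespace MixedBraid

/-- The defining relators of the Artin braid group on `N` strands, whose generators are indexed
from `0`: the generator `k : Fin (N - 1)` crosses the strands at positions `k` and `k + 1`. -/
inductive BraidRel (N : ℕ) : FreeGroup (Fin (N - 1)) → Prop
  | comm (k l : Fin (N - 1)) (h : (k : ℕ) + 2 ≤ l) :
      BraidRel N (FreeGroup.of k * FreeGroup.of l * (FreeGroup.of l * FreeGroup.of k)⁻¹)
  | braid (k l : Fin (N - 1)) (h : (k : ℕ) + 1 = l) :
      BraidRel N (FreeGroup.of k * FreeGroup.of l * FreeGroup.of k *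
        (FreeGroup.of l * FreeGroup.of k * FreeGroup.of l)⁻¹)

/-- The classical Artin braid group on `N` strands. -/
abbrev BraidGroup (N : ℕ) : Type := PresentedGroup {r | BraidRel N r}

/-- The elementary crossing of positions `k` and `k + 1`, as an element of the braid group on `N`
strands. (It is only used for `k + 1 < N`; outside this range it is `1` by convention.) -/
def sigma (N k : ℕ) : BraidGroup N :=
  if h : k + 1 < N then PresentedGroup.of ⟨k, by omega⟩ else 1

/-- The homomorphism from the braid group to `G` determined by the images of the generators. -/
def braidLift {N : ℕ} {G : Type*} [Group G] (f : Fin (N - 1) → G)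
    (hc : ∀ k l : Fin (N - 1), (k : ℕ) + 2 ≤ l → f k * f l = f l * f k)
    (hb : ∀ k l : Fin (N - 1), (k : ℕ) + 1 = l → f k * f l * f k = f l * f k * f l) :
    BraidGroup N →* G :=
  PresentedGroup.toGroup (f := f) (by
    rintro r (⟨k, l, h⟩ | ⟨k, l, h⟩)
    · simp only [map_mul, map_inv, FreeGroup.lift_apply_of]
      rw [hc k l h, mul_inv_cancel]
    · simp only [map_mul, map_inv, FreeGroup.lift_apply_of]
      rw [hb k l h, mul_inv_cancel])

theorem sigma_comm (N k l : ℕ) (h : k + 2 ≤ l) :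
    sigma N k * sigma N l = sigma N l * sigma N k := by
  unfold sigma
  split_ifs with h1 h2
  · have := PresentedGroup.one_of_mem (rels := {r | BraidRel N r})
      (BraidRel.comm (N := N) ⟨k, by omega⟩ ⟨l, by omega⟩ h)
    rw [map_mul, map_inv, mul_inv_eq_one, map_mul, map_mul] at this
    exact this
  all_goals simp

theorem sigma_braid (N k : ℕ) (h : k + 2 < N) :
    sigma N k * sigma N (k + 1) * sigma N k = sigma N (k + 1) * sigma N k * sigma N (k + 1) := by
  unfold sigma
  rw [dif_pos (by omega), dif_pos (by omega)]
  have := PresentedGroup.one_of_mem (rels := {r | BraidRel N r})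
    (BraidRel.braid (N := N) ⟨k, by omega⟩ ⟨k + 1, by omega⟩ rfl)
  rw [map_mul, map_inv, mul_inv_eq_one, map_mul, map_mul, map_mul, map_mul] at this
  exact this

/-- The transposition of the positions `k` and `k + 1`. -/
def adjSwap {N : ℕ} (k : Fin (N - 1)) : Equiv.Perm (Fin N) :=
  Equiv.swap ⟨k, by omega⟩ ⟨k + 1, by omega⟩

theorem adjSwap_apply {N : ℕ} (k : Fin (N - 1)) (x : Fin N) :
    ((adjSwap k x : Fin N) : ℕ) =
      if (x : ℕ) = k then (k : ℕ) + 1 else if (x : ℕ) = k + 1 then (k : ℕ) else x := by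
  unfold adjSwap
  rw [Equiv.swap_apply_def]
  simp only [Fin.ext_iff]
  split_ifs <;> rfl

theorem adjSwap_comm {N : ℕ} (k l : Fin (N - 1)) (h : (k : ℕ) + 2 ≤ l) :
    adjSwap k * adjSwap l = adjSwap l * adjSwap k := by
  ext x
  simp only [Equiv.Perm.mul_apply, adjSwap_apply]
  split_ifs <;> omega

theorem adjSwap_braid {N : ℕ} (k l : Fin (N - 1)) (h : (k : ℕ) + 1 = l) :
    adjSwap k * adjSwap l * adjSwap k = adjSwap l * adjSwap k * adjSwap l := by
  obtain ⟨k, hk⟩ := k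
  obtain ⟨l, hl⟩ := l
  obtain rfl : k + 1 = l := h
  have key : ∀ x y z : Fin N, x ≠ y → y ≠ z → x ≠ z →
      Equiv.swap x y * Equiv.swap y z * Equiv.swap x y =
        Equiv.swap y z * Equiv.swap x y * Equiv.swap y z := by
    intro x y z hxy hyz hxz
    rw [Equiv.swap_mul_swap_mul_swap hxy hxz, Equiv.swap_comm x y, Equiv.swap_comm y z,
      Equiv.swap_mul_swap_mul_swap hyz.symm hxz.symm, Equiv.swap_comm]
  refine key _ _ _ ?_ ?_ ?_ <;> simp only [ne_eq, Fin.mk.injEq] <;> omega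

/-- The permutation of the end points induced by a braid. -/
def braidPerm (N : ℕ) : BraidGroup N →* Equiv.Perm (Fin N) :=
  braidLift adjSwap adjSwap_comm adjSwap_braid

/-- The pure braid group on `N` strands. -/
def pureBraidGroup (N : ℕ) : Subgroup (BraidGroup N) := (braidPerm N).ker

/-- The set of positions occupied, at a given level of a braid on `N` strands, by `m` chosen
strands. -/
abbrev Positions (N m : ℕ) : Type := {S : Finset (Fin N) // S.card = m}

/-- The positions of the chosen strands on the other side of a crossing of `k` and `k + 1`. -/
def movePos {N m : ℕ} (k : Fin (N - 1)) (S : Positions N m) : Positions N m :=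
  ⟨S.1.map (adjSwap k).toEmbedding, by rw [Finset.card_map, S.2]⟩

/-- The number of chosen strands at positions smaller than `x`. -/
def rank {N m : ℕ} (S : Positions N m) (x : ℕ) : ℕ := (S.1.filter (fun y : Fin N => (y : ℕ) < x)).card

/-- What is left of the crossing of positions `k` and `k + 1` when all but the strands at the
positions in `S` are erased: a crossing of the braid on the `m` remaining strands if both crossing
strands are kept, and nothing otherwise. -/
noncomputable def restCrossing {N m : ℕ} (k : Fin (N - 1)) (S : Positions N m) : BraidGroup m :=
  if (⟨k, by omega⟩ : Fin N) ∈ S.1 ∧ (⟨k + 1, by omega⟩ : Fin N) ∈ S.1 then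
    sigma m (rank S k) else 1

/-- The position with number `x` (from `0`) exists and is in `S`. -/
def occ {N m : ℕ} (S : Positions N m) (x : ℕ) : Prop := ∃ h : x < N, (⟨x, h⟩ : Fin N) ∈ S.1

theorem mem_movePos {N m : ℕ} (k : Fin (N - 1)) (S : Positions N m) (y : Fin N) :
    y ∈ (movePos k S).1 ↔ adjSwap k y ∈ S.1 := by
  simp only [movePos, Finset.mem_map_equiv]
  have : (adjSwap k).symm = adjSwap k := Equiv.symm_swap _ _
  rw [this]

theorem occ_movePos {N m : ℕ} (k : Fin (N - 1)) (S : Positions N m) (x : ℕ) :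
    occ (movePos k S) x ↔
      occ S (if x = (k : ℕ) then (k : ℕ) + 1 else if x = k + 1 then (k : ℕ) else x) := by
  constructor
  · rintro ⟨h, hx⟩
    rw [mem_movePos] at hx
    have := adjSwap_apply k ⟨x, h⟩
    simp only at this
    rw [← this]
    exact ⟨(adjSwap k ⟨x, h⟩).2, hx⟩
  · rintro ⟨h, hx⟩
    have hk := k.2
    have hx' : x < N := by split_ifs at h <;> omega
    refine ⟨hx', (mem_movePos k S _).2 ?_⟩
    convert hx using 1
    exact Fin.ext (adjSwap_apply k ⟨x, hx'⟩)

theorem occ_movePos_left {N m : ℕ} (k : Fin (N - 1)) (S : Positions N m) :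
    occ (movePos k S) k ↔ occ S (k + 1) := by
  rw [occ_movePos, if_pos rfl]

theorem occ_movePos_right {N m : ℕ} (k : Fin (N - 1)) (S : Positions N m) :
    occ (movePos k S) (k + 1) ↔ occ S k := by
  rw [occ_movePos, if_neg (by omega), if_pos rfl]

theorem occ_movePos_of_ne {N m : ℕ} (k : Fin (N - 1)) (S : Positions N m) (x : ℕ)
    (h1 : x ≠ k) (h2 : x ≠ k + 1) : occ (movePos k S) x ↔ occ S x := by
  rw [occ_movePos, if_neg h1, if_neg h2]

open Classical in
theorem rank_succ {N m : ℕ} (S : Positions N m) (x : ℕ) :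
    rank S (x + 1) = rank S x + if occ S x then 1 else 0 := by
  unfold rank
  split_ifs with h
  · obtain ⟨hx, hS⟩ := h
    have : S.1.filter (fun y : Fin N => (y : ℕ) < x + 1) =
        insert ⟨x, hx⟩ (S.1.filter (fun y : Fin N => (y : ℕ) < x)) := by
      ext y
      simp only [Finset.mem_filter, Finset.mem_insert, Fin.ext_iff]
      constructor
      · rintro ⟨h1, h2⟩
        by_cases hy : (y : ℕ) = x
        · exact Or.inl hy
        · exact Or.inr ⟨h1, by omega⟩
      · rintro (h1 | h1)
        · exact ⟨by convert hS, by omega⟩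
        · exact ⟨h1.1, by omega⟩
    rw [this, Finset.card_insert_of_notMem (by simp)]
  · rw [add_zero]
    congr 1
    ext y
    simp only [Finset.mem_filter]
    refine ⟨fun ⟨h1, h2⟩ => ⟨h1, ?_⟩, fun ⟨h1, h2⟩ => ⟨h1, by omega⟩⟩
    by_contra hy
    have : (y : ℕ) = x := by omega
    exact h ⟨this ▸ y.2, by convert h1; exact this.symm⟩

theorem rank_le {N m : ℕ} (S : Positions N m) (x : ℕ) : rank S x ≤ m :=
  (Finset.card_filter_le _ _).trans_eq S.2

theorem rank_mono {N m : ℕ} (S : Positions N m) {x y : ℕ} (h : x ≤ y) : rank S x ≤ rank S y :=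
  Finset.card_le_card (Finset.monotone_filter_right _ (fun _ _ hz => lt_of_lt_of_le hz h))

theorem rank_movePos {N m : ℕ} (k : Fin (N - 1)) (S : Positions N m) (x : ℕ)
    (h : x ≠ (k : ℕ) + 1) : rank (movePos k S) x = rank S x := by
  unfold rank
  have : (movePos k S).1.filter (fun y : Fin N => (y : ℕ) < x) =
      (S.1.filter (fun y : Fin N => (y : ℕ) < x)).map (adjSwap k).toEmbedding := by
    simp only [movePos, Finset.filter_map]
    congr 1
    ext y
    simp only [Finset.mem_filter, Function.comp, Equiv.coe_toEmbedding, adjSwap_apply]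
    refine and_congr_right fun _ => ?_
    split_ifs <;> omega
  rw [this, Finset.card_map]

open Classical in
theorem restCrossing_eq {N m : ℕ} (k : Fin (N - 1)) (S : Positions N m) :
    restCrossing k S = if occ S k ∧ occ S (k + 1) then sigma m (rank S k) else 1 := by
  unfold restCrossing
  refine if_congr ?_ rfl rfl
  constructor
  · rintro ⟨h1, h2⟩; exact ⟨⟨_, h1⟩, ⟨_, h2⟩⟩
  · rintro ⟨⟨_, h1⟩, ⟨_, h2⟩⟩; exact ⟨h1, h2⟩

theorem movePos_movePos {N m : ℕ} (k : Fin (N - 1)) (S : Positions N m) :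
    movePos k (movePos k S) = S := by
  apply Subtype.ext
  ext y
  simp [movePos, adjSwap]

theorem restCrossing_movePos {N m : ℕ} (k : Fin (N - 1)) (S : Positions N m) :
    restCrossing k (movePos k S) = restCrossing k S := by
  classical
  rw [restCrossing_eq, restCrossing_eq, rank_movePos _ _ _ (by omega)]
  refine if_congr ?_ rfl rfl
  rw [occ_movePos_left, occ_movePos_right, and_comm]

/-- Passing one crossing, while keeping track of the positions of the `m` chosen strands and of the
braid on `m` strands that they have formed so far. -/
noncomputable def eraseStep {N m : ℕ} (k : Fin (N - 1)) :
    Equiv.Perm (Positions N m × BraidGroup m) where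
  toFun x := (movePos k x.1, restCrossing k x.1 * x.2)
  invFun x := (movePos k x.1, (restCrossing k x.1)⁻¹ * x.2)
  left_inv x := by simp [movePos_movePos, restCrossing_movePos]
  right_inv x := by simp [movePos_movePos, restCrossing_movePos]

theorem movePos_comp {N m : ℕ} (k l : Fin (N - 1)) (h : (k : ℕ) + 2 ≤ l) (S : Positions N m) :
    movePos k (movePos l S) = movePos l (movePos k S) := by
  apply Subtype.ext
  ext y
  simp only [mem_movePos]
  have := congrArg (fun f : Equiv.Perm (Fin N) => f y) (adjSwap_comm k l h)
  simp only [Equiv.Perm.mul_apply] at this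
  rw [this]

theorem movePos_braid {N m : ℕ} (k l : Fin (N - 1)) (h : (k : ℕ) + 1 = l) (S : Positions N m) :
    movePos k (movePos l (movePos k S)) = movePos l (movePos k (movePos l S)) := by
  apply Subtype.ext
  ext y
  simp only [mem_movePos]
  have := congrArg (fun f : Equiv.Perm (Fin N) => f y) (adjSwap_braid k l h)
  simp only [Equiv.Perm.mul_apply] at this
  rw [this]

theorem eraseStep_comm {N m : ℕ} (k l : Fin (N - 1)) (h : (k : ℕ) + 2 ≤ l) :
    (eraseStep k * eraseStep l : Equiv.Perm (Positions N m × BraidGroup m)) =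
      eraseStep l * eraseStep k := by
  classical
  refine Equiv.ext fun x => ?_
  obtain ⟨S, b⟩ := x
  refine Prod.ext (movePos_comp k l h S) ?_
  change restCrossing k (movePos l S) * (restCrossing l S * b) =
    restCrossing l (movePos k S) * (restCrossing k S * b)
  rw [← mul_assoc, ← mul_assoc]
  congr 1
  have h1 : restCrossing k (movePos l S) = restCrossing k S := by
    rw [restCrossing_eq, restCrossing_eq, rank_movePos _ _ _ (by omega),
      occ_movePos_of_ne _ _ _ (by omega) (by omega), occ_movePos_of_ne _ _ _ (by omega) (by omega)]
  have h2 : restCrossing l (movePos k S) = restCrossing l S := by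
    rw [restCrossing_eq, restCrossing_eq, rank_movePos _ _ _ (by omega),
      occ_movePos_of_ne _ _ _ (by omega) (by omega), occ_movePos_of_ne _ _ _ (by omega) (by omega)]
  rw [h1, h2, restCrossing_eq, restCrossing_eq]
  split_ifs with hk hl
  · refine sigma_comm _ _ _ ?_
    have e1 := rank_succ S k
    have e2 := rank_succ S (k + 1)
    have e3 := rank_mono S h
    rw [if_pos hk.1] at e1
    rw [if_pos hk.2] at e2
    have e4 : rank S ((k : ℕ) + 1 + 1) = rank S ((k : ℕ) + 2) := rfl
    omega
  all_goals simp

theorem eraseStep_braid {N m : ℕ} (k l : Fin (N - 1)) (h : (k : ℕ) + 1 = l) :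
    (eraseStep k * eraseStep l * eraseStep k : Equiv.Perm (Positions N m × BraidGroup m)) =
      eraseStep l * eraseStep k * eraseStep l := by
  classical
  refine Equiv.ext fun x => ?_
  obtain ⟨S, b⟩ := x
  refine Prod.ext (movePos_braid k l h S) ?_
  change restCrossing k (movePos l (movePos k S)) * (restCrossing l (movePos k S) *
      (restCrossing k S * b)) =
    restCrossing l (movePos k (movePos l S)) * (restCrossing k (movePos l S) *
      (restCrossing l S * b))
  rw [← mul_assoc, ← mul_assoc, ← mul_assoc, ← mul_assoc]
  congr 1
  obtain ⟨k, hk⟩ := k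
  obtain ⟨l, hl⟩ := l
  obtain rfl : k + 1 = l := h
  have r1 : ∀ T : Positions N m, rank T (k + 1) = rank T k + if occ T k then 1 else 0 :=
    fun T => rank_succ T k
  have r2 := rank_succ S (k + 1)
  have r3 := rank_succ S (k + 1 + 1)
  have r4 := rank_le S (k + 1 + 1 + 1)
  have o1 : ∀ T : Positions N m, rank (movePos ⟨k, hk⟩ T) k = rank T k :=
    fun T => rank_movePos _ _ _ (by simp)
  have o2 : ∀ T : Positions N m, rank (movePos ⟨k + 1, hl⟩ T) k = rank T k :=
    fun T => rank_movePos _ _ _ (show k ≠ k + 1 + 1 by omega)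
  have p1 : ∀ T : Positions N m, occ (movePos ⟨k, hk⟩ T) k ↔ occ T (k + 1) :=
    fun T => occ_movePos_left _ _
  have p2 : ∀ T : Positions N m, occ (movePos ⟨k, hk⟩ T) (k + 1) ↔ occ T k :=
    fun T => occ_movePos_right _ _
  have p3 : ∀ T : Positions N m, occ (movePos ⟨k, hk⟩ T) (k + 1 + 1) ↔ occ T (k + 1 + 1) :=
    fun T => occ_movePos_of_ne _ _ _ (show k + 1 + 1 ≠ k by omega)
      (show k + 1 + 1 ≠ k + 1 by omega)
  have q1 : ∀ T : Positions N m, occ (movePos ⟨k + 1, hl⟩ T) k ↔ occ T k :=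
    fun T => occ_movePos_of_ne _ _ _ (show k ≠ k + 1 by omega) (show k ≠ k + 1 + 1 by omega)
  have q2 : ∀ T : Positions N m, occ (movePos ⟨k + 1, hl⟩ T) (k + 1) ↔ occ T (k + 1 + 1) :=
    fun T => occ_movePos_left _ _
  have q3 : ∀ T : Positions N m, occ (movePos ⟨k + 1, hl⟩ T) (k + 1 + 1) ↔ occ T (k + 1) :=
    fun T => occ_movePos_right _ _
  simp only [restCrossing_eq, r1, o1, o2, p1, p2, p3, q1, q2, q3]
  by_cases a : occ S k <;> by_cases b : occ S (k + 1) <;> by_cases c : occ S (k + 1 + 1) <;>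
    simp [a, b, c]
  refine sigma_braid _ _ ?_
  simp only [a, b, c, if_true, r1] at r2 r3 r4
  omega

/-- The action of the braid group on `N` strands that records the erasing of strands. A braid `β`
sends `(S, b)` to `(T, c * b)`, where `T` is the set of positions at the far end of `β` of the `m`
strands of `β` that occupy the positions `S` at the near end, and `c` is the braid on `m` strands
that is left of `β` when all its other strands are removed. -/
noncomputable def erase (N m : ℕ) : BraidGroup N →* Equiv.Perm (Positions N m × BraidGroup m) :=
  braidLift eraseStep eraseStep_comm eraseStep_braid

/-- The first `m` of `m + n` positions. -/
def firstPositions (m n : ℕ) : Positions (m + n) m :=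
  ⟨Finset.univ.map (Fin.castAddEmb n), by simp⟩

/-- The mixed braid group `B_{m,n}`: the braids on `m + n` strands that become the identity braid
on the first `m` positions when the last `n` strands are removed. -/
noncomputable def mixedBraidGroup (m n : ℕ) : Subgroup (BraidGroup (m + n)) :=
  (MulAction.stabilizer (Equiv.Perm (Positions (m + n) m × BraidGroup m))
    (firstPositions m n, (1 : BraidGroup m))).comap (erase (m + n) m)

/-- The pure mixed braid group `P_{m,n} = B_{m,n} ∩ P_{m+n}`. -/
noncomputable def pureMixedBraidGroup (m n : ℕ) : Subgroup (BraidGroup (m + n)) :=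
  mixedBraidGroup m n ⊓ pureBraidGroup (m + n)

/-- The pure braid generator
`a_{ij} = σ_{j-1} ⋯ σ_{i+1} σ_i² σ_{i+1}⁻¹ ⋯ σ_{j-1}⁻¹` for `i < j`, with strands and elementary
crossings numbered from `0`. -/
def pureGen {N : ℕ} (i j : Fin N) : BraidGroup N :=
  ((List.Ico (i + 1) j).reverse.map (sigma N)).prod * sigma N i ^ 2 *
    ((List.Ico (i + 1) j).reverse.map (sigma N)).prod⁻¹

/-- The pairs `(i, j)` of strands with `i < j` for which `j` is not among the first `m` strands. -/
abbrev GenIndex (m n : ℕ) : Type :=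
  {p : Fin (m + n) × Fin (m + n) // p.1 < p.2 ∧ m ≤ (p.2 : ℕ)}

/-- The free generator that stands for `a_{ij}`. -/
def gen {m n : ℕ} (i j : Fin (m + n)) (h : i < j) (hm : m ≤ (j : ℕ)) : FreeGroup (GenIndex m n) :=
  FreeGroup.of ⟨(i, j), h, hm⟩

/-- The pure braid relations, restricted to the generators `a_{ij}` for which `j` is not among the
first `m` strands, as a relation between two words. -/
inductive PureBraidRel (m n : ℕ) : FreeGroup (GenIndex m n) → FreeGroup (GenIndex m n) → Prop
  | P1 (i j r s : Fin (m + n)) (hij : i < j) (hrs : r < s) (hj : m ≤ (j : ℕ)) (hs : m ≤ (s : ℕ))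
      (h : j < r ∨ (r < i ∧ j < s)) :
      PureBraidRel m n ((gen i j hij hj)⁻¹ * gen r s hrs hs * gen i j hij hj) (gen r s hrs hs)
  | P2 (i j s : Fin (m + n)) (hij : i < j) (hjs : j < s) (his : i < s)
      (hj : m ≤ (j : ℕ)) (hs : m ≤ (s : ℕ)) :
      PureBraidRel m n ((gen i j hij hj)⁻¹ * gen j s hjs hs * gen i j hij hj)
        (gen i s his hs * gen j s hjs hs * (gen i s his hs)⁻¹)
  | P3 (i j s : Fin (m + n)) (hij : i < j) (hjs : j < s) (his : i < s)
      (hj : m ≤ (j : ℕ)) (hs : m ≤ (s : ℕ)) :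
      PureBraidRel m n ((gen i j hij hj)⁻¹ * gen i s his hs * gen i j hij hj)
        (gen i s his hs * gen j s hjs hs * gen i s his hs * (gen j s hjs hs)⁻¹ *
          (gen i s his hs)⁻¹)
  | P4 (i r j s : Fin (m + n)) (hir : i < r) (hrj : r < j) (hij : i < j) (hjs : j < s)
      (his : i < s) (hrs : r < s) (hj : m ≤ (j : ℕ)) (hs : m ≤ (s : ℕ)) :
      PureBraidRel m n ((gen i j hij hj)⁻¹ * gen r s hrs hs * gen i j hij hj)
        (gen i s his hs * gen j s hjs hs * (gen i s his hs)⁻¹ * (gen j s hjs hs)⁻¹ *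
          gen r s hrs hs * gen j s hjs hs * gen i s his hs * (gen j s hjs hs)⁻¹ *
          (gen i s his hs)⁻¹)

/-- The relators `u * v⁻¹` of the pure braid relations `u = v`. -/
def pureBraidRelators (m n : ℕ) : Set (FreeGroup (GenIndex m n)) :=
  {w | ∃ u v, PureBraidRel m n u v ∧ w = u * v⁻¹}

/-- The homomorphism that adds a trivial strand at the last position. -/
def addStrand (N : ℕ) : BraidGroup N →* BraidGroup (N + 1) :=
  braidLift (fun k => sigma (N + 1) k) (fun _ _ h => sigma_comm _ _ _ h)
    (fun k l h => by
      have := l.2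
      rw [← h]
      exact sigma_braid _ _ (by omega))

end MixedBraid

/-! Strands are counted from 1 in this paragraph and the next two. The core is Artin's combing of
the full braid group: the braids in B_{N+1} whose last strand ends at the last position form F_N ⋊
B_N, with F_N free on the a_{i,N+1} and B_N acting by Artin's automorphisms. The braid relations
show that σ_k conjugates the a_{i,N+1} exactly as its Artin automorphism transforms the free
generators; this gives `comb : F_N ⋊ B_N → B_{N+1}`. Injectivity is proved without topology. If G =
F_N ⋊ B_N is to be the stabilizer of the last position, then left multiplication on B_{N+1} must
become, through coset representatives, an action on positions × G given by a cocycle. That action is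
defined outright and the braid relations are checked for it. Then `comb h` multiplies the fibre over
the last position by h (`combAction_comb`), so `comb` is injective, and equivariance
(`combAction_snd`) identifies its image (`mem_range_comb`).

For N = m + k, the generators a_{i,N+1} wind only around a strand that gets erased, and erasing does
not see an added strand. Hence P_{m,k+1} consists of the `comb g` with B_N-component of g in P_{m,k}
(`comb_mem_pureMixedBraidGroup`), which is the combing of P_{m,n}.

The presentation follows by induction on n. Let Q_k be the group presented by the relations on m + k
strands. The relations with s = m + k + 1 give a surjection F ⋊ Q_k → Q_{k+1} (`presComb`). Its
composite with Q_{k+1} → B_{N+1} is F ⋊ Q_k → F ⋊ B_N → B_{N+1}, injective by the induction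
hypothesis. So Q_{k+1} → B_{N+1} is injective with the same image, P_{m,k+1}. -/

namespace MixedBraid

/-! ### Pure braid relations inside the Artin braid group -/

/-- The element `a_{ij}` of the braid group on `N` strands, indexed by natural numbers. -/
def pureElt (N i j : ℕ) : BraidGroup N :=
  ((List.Ico (i + 1) j).reverse.map (sigma N)).prod * sigma N i ^ 2 *
    ((List.Ico (i + 1) j).reverse.map (sigma N)).prod⁻¹

theorem pureGen_eq {N : ℕ} (i j : Fin N) : pureGen i j = pureElt N i j := rfl

theorem pureElt_self_succ (N i : ℕ) : pureElt N i (i + 1) = sigma N i ^ 2 := by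
  simp [pureElt]

/-- The recursion behind the inductions on the second index below. -/
theorem pureElt_succ (N : ℕ) {i j : ℕ} (h : i < j) :
    pureElt N i (j + 1) = sigma N j * pureElt N i j * (sigma N j)⁻¹ := by
  simp only [pureElt, List.Ico.succ_top (show i + 1 ≤ j from h), List.reverse_append,
    List.map_append, List.prod_append]
  simp [mul_assoc]

theorem sigma_commute (N k l : ℕ) (h : k + 2 ≤ l ∨ l + 2 ≤ k) :
    Commute (sigma N k) (sigma N l) := by
  rcases h with h | h
  · exact sigma_comm N k l h
  · exact (sigma_comm N l k h).symm

/-- An element commuting with all crossings that occur in `a_{ij}` commutes with `a_{ij}`. -/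
theorem commute_pureElt {N i j : ℕ} (hij : i < j) {x : BraidGroup N}
    (h : ∀ k, i ≤ k → k < j → Commute x (sigma N k)) : Commute x (pureElt N i j) := by
  induction j, hij using Nat.le_induction with
  | base => rw [pureElt_self_succ]; exact (h i le_rfl (by omega)).pow_right 2
  | succ j hj ih =>
    rw [pureElt_succ N (show i < j from hj)]
    have h1 := h j (by omega) (by omega)
    exact (h1.mul_right (ih fun k h1 h2 => h k h1 (by omega))).mul_right h1.inv_right

/-- The braid relation says that ab conjugates a to b, hence a² to b². -/
theorem braid_conj_sq {G : Type*} [Group G] {a b : G} (h : a * b * a = b * a * b) :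
    a * (b * a ^ 2 * b⁻¹) * a⁻¹ = b ^ 2 := by
  have : a * (b * a ^ 2) = b ^ 2 * (a * b) := by
    calc a * (b * a ^ 2) = a * b * a * a := by simp only [pow_two, mul_assoc]
      _ = b * a * b * a := by rw [h]
      _ = b * (a * b * a) := by simp only [mul_assoc]
      _ = b ^ 2 * (a * b) := by rw [h]; simp only [pow_two, mul_assoc]
  calc a * (b * a ^ 2 * b⁻¹) * a⁻¹ = a * (b * a ^ 2) * b⁻¹ * a⁻¹ := by group
    _ = _ := by rw [this]; group

/-- For s = k + 2 this is the braid relation; each further crossing σ_s commutes with σ_k. With the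
next two lemmas it shows that conjugation by σ_k follows Artin's formulas. -/
theorem sigma_conj_pureElt_left {N k s : ℕ} (h : k + 1 < s) (hs : s < N) :
    sigma N k * pureElt N k s * (sigma N k)⁻¹ = pureElt N (k + 1) s := by
  induction s, h using Nat.le_induction with
  | base =>
    rw [pureElt_succ N (by omega), pureElt_self_succ, pureElt_self_succ]
    exact braid_conj_sq (sigma_braid N k (by omega))
  | succ s h ih =>
    rw [pureElt_succ N (by omega), pureElt_succ N (by omega), ← ih (by omega)]
    have := sigma_commute N k s (by omega)
    rw [← mul_assoc, ← mul_assoc, this.eq]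
    simp only [mul_assoc]
    rw [← this.inv_inv.eq]

theorem sigma_conj_pureElt_right {N k s : ℕ} (h : k + 1 < s) (hs : s < N) :
    sigma N k * pureElt N (k + 1) s * (sigma N k)⁻¹ =
      (pureElt N (k + 1) s)⁻¹ * pureElt N k s * pureElt N (k + 1) s := by
  induction s, h using Nat.le_induction with
  | base =>
    rw [pureElt_self_succ, pureElt_succ N (show k < k + 1 by omega), pureElt_self_succ]
    have h := braid_conj_sq (sigma_braid N k (by omega)).symm
    have e : sigma N k * sigma N (k + 1) ^ 2 * (sigma N k)⁻¹ =
      (sigma N (k + 1))⁻¹ * sigma N k ^ 2 * sigma N (k + 1) := by rw [← h]; group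
    rw [e]; group
  | succ s h ih =>
    have := sigma_commute N k s (by omega)
    rw [pureElt_succ N (by omega), pureElt_succ N (by omega)]
    calc _ = sigma N s * (sigma N k * pureElt N (k + 1) s * (sigma N k)⁻¹) * (sigma N s)⁻¹ := by
          rw [← mul_assoc, ← mul_assoc, this.eq]
          simp only [mul_assoc]
          rw [← this.inv_inv.eq]
      _ = _ := by rw [ih (by omega)]; group

/-- Either the crossings are far apart, or i < k and k + 1 < j, where σ_k meets both σ_k and σ_{k+1}
in the word for a_{ij} and slides through it. -/
theorem sigma_commute_pureElt {N k i j : ℕ} (hij : i < j) (hj : j < N) (h1 : k ≠ i)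
    (h2 : k + 1 ≠ i) (h3 : k + 1 ≠ j) (h4 : k ≠ j) :
    Commute (sigma N k) (pureElt N i j) := by
  by_cases hc : k + 1 < i ∨ j < k
  · exact commute_pureElt hij fun l _ _ => sigma_commute _ _ _ (by omega)
  have hik : i < k := by omega
  have hkj : k + 1 < j := by omega
  clear hij h1 h2 h3 h4 hc
  induction j, hkj using Nat.le_induction with
  | base =>
    -- The generator is σ_{k+1} σ_k a_{ik} σ_k⁻¹ σ_{k+1}⁻¹. The braid relation turns the extra σ_k
    -- on the left into a σ_{k+1} next to a_{ik}, with which it commutes.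
    rw [pureElt_succ N (by omega), pureElt_succ N hik]
    have hb := sigma_braid N k (by omega)
    have hc : Commute (sigma N (k + 1)) (pureElt N i k) :=
      commute_pureElt hik fun l _ _ => sigma_commute _ _ _ (by omega)
    refine mul_inv_eq_iff_eq_mul.1 (?_ : sigma N k * _ * (sigma N k)⁻¹ = _)
    calc _ = sigma N k * sigma N (k + 1) * sigma N k * pureElt N i k *
          (sigma N k * sigma N (k + 1) * sigma N k)⁻¹ := by group
      _ = sigma N (k + 1) * sigma N k * (sigma N (k + 1) * pureElt N i k) *
          (sigma N (k + 1) * sigma N k * sigma N (k + 1))⁻¹ := by rw [hb]; group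
      _ = _ := by rw [hc.eq]; group
  | succ j h ih =>
    rw [pureElt_succ N (by omega)]
    have := sigma_commute N k j (by omega)
    exact (this.mul_right (ih (by omega))).mul_right this.inv_right

/-- Far or nested pure generators commute. -/
theorem pureElt_commute {N i j r s : ℕ} (hij : i < j) (hrs : r < s) (hs : s < N)
    (h : j < r ∨ (r < i ∧ j < s)) : Commute (pureElt N r s) (pureElt N i j) :=
  commute_pureElt hij fun _ _ _ =>
    (sigma_commute_pureElt hrs hs (by omega) (by omega) (by omega) (by omega)).symm

/-- The conjugation action of `a_{ij}` on the `a_{rs}` with `i ≤ r ≤ j`. -/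
theorem pureElt_conj {N i j s : ℕ} (hij : i < j) (hjs : j < s) (hs : s < N) :
    (pureElt N i j)⁻¹ * pureElt N j s * pureElt N i j =
        pureElt N i s * pureElt N j s * (pureElt N i s)⁻¹ ∧
      (pureElt N i j)⁻¹ * pureElt N i s * pureElt N i j =
        pureElt N i s * pureElt N j s * pureElt N i s * (pureElt N j s)⁻¹ * (pureElt N i s)⁻¹ ∧
      ∀ r, i < r → r < j → (pureElt N i j)⁻¹ * pureElt N r s * pureElt N i j =
        pureElt N i s * pureElt N j s * (pureElt N i s)⁻¹ * (pureElt N j s)⁻¹ *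
          pureElt N r s * pureElt N j s * pureElt N i s * (pureElt N j s)⁻¹ *
          (pureElt N i s)⁻¹ := by
  induction j, hij using Nat.le_induction with
  | base =>
    have h1 := sigma_conj_pureElt_left hjs hs
    have h2 := sigma_conj_pureElt_right hjs hs
    simp only [pureElt_self_succ, Nat.succ_eq_add_one]
    -- Here a_{i,i+1} = σ_i², so the relations come from inverting the formulas for conjugation by
    -- σ_i and applying the result twice.
    have h3 : ∀ x y : BraidGroup N, sigma N i * x * (sigma N i)⁻¹ = y →
      (sigma N i)⁻¹ * y * sigma N i = x := by rintro x _ rfl; group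
    have h4 : (sigma N i)⁻¹ * pureElt N i s * sigma N i =
        pureElt N i s * pureElt N (i + 1) s * (pureElt N i s)⁻¹ := by
      apply h3
      calc _ = (sigma N i * pureElt N i s * (sigma N i)⁻¹) *
            (sigma N i * pureElt N (i + 1) s * (sigma N i)⁻¹) *
            (sigma N i * pureElt N i s * (sigma N i)⁻¹)⁻¹ := by group
        _ = _ := by rw [h1, h2]; group
    have h5 := h3 _ _ h1
    have h6 : ∀ x, (sigma N i ^ 2)⁻¹ * x * sigma N i ^ 2 =
      (sigma N i)⁻¹ * ((sigma N i)⁻¹ * x * sigma N i) * sigma N i := by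
      intro x; simp only [pow_two, mul_inv_rev, mul_assoc]
    refine ⟨?_, ?_, fun r _ _ => by omega⟩
    · rw [h6, h5, h4]
    · rw [h6, h4]
      calc _ = ((sigma N i)⁻¹ * pureElt N i s * sigma N i) *
            ((sigma N i)⁻¹ * pureElt N (i + 1) s * sigma N i) *
            ((sigma N i)⁻¹ * pureElt N i s * sigma N i)⁻¹ := by group
        _ = _ := by rw [h4, h5]; group
  | succ j h ih =>
    obtain ⟨c1, c2, c3⟩ := ih (by omega)
    have h1 := sigma_conj_pureElt_left hjs hs
    have h2 := sigma_conj_pureElt_right hjs hs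
    have hi : sigma N j * pureElt N i s * (sigma N j)⁻¹ = pureElt N i s := by
      rw [mul_inv_eq_iff_eq_mul]
      exact (sigma_commute_pureElt (by omega) hs (by omega) (by omega) (by omega) (by omega)).eq
    have h0 : (pureElt N i j)⁻¹ * pureElt N (j + 1) s * pureElt N i j = pureElt N (j + 1) s := by
      rw [mul_assoc, (pureElt_commute (by omega) hjs hs (by omega)).eq, inv_mul_cancel_left]
    rw [pureElt_succ N (by omega)]
    -- Kept so that a_{rs} with r = j can still be recognized as `xj` once the generators are
    -- generalized.
    have he : ∀ r, r = j → pureElt N r s = pureElt N j s := by rintro _ rfl; rfl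
    generalize pureElt N i s = xi at *
    generalize pureElt N j s = xj at *
    generalize pureElt N (j + 1) s = xk at *
    generalize hg : sigma N j = g at *
    generalize pureElt N i j = a at *
    -- Since a_{i,j+1} = g a g⁻¹, it suffices to write each a_{rs} as g x g⁻¹ with the conjugate of
    -- x by a known from the induction hypothesis.
    have key : ∀ x, (g * a * g⁻¹)⁻¹ * (g * x * g⁻¹) * (g * a * g⁻¹) =
      g * (a⁻¹ * x * a) * g⁻¹ := by intro x; group
    refine ⟨?_, ?_, fun r h1r h2r => ?_⟩
    · conv_lhs => rw [← h1, key, c1]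
      calc _ = (g * xi * g⁻¹) * (g * xj * g⁻¹) * (g * xi * g⁻¹)⁻¹ := by group
        _ = _ := by rw [hi, h1]
    · conv_lhs => rw [← hi, key, c2]
      calc _ = (g * xi * g⁻¹) * (g * xj * g⁻¹) * (g * xi * g⁻¹) * (g * xj * g⁻¹)⁻¹ *
            (g * xi * g⁻¹)⁻¹ := by group
        _ = _ := by rw [hi, h1]
    · by_cases hr : r = j
      · rw [he r hr]
        -- For r = j the element x is not a generator but this word, in which `xk` commutes with a
        -- by `h0`.
        have h3 : g * (xj * xk * xj⁻¹) * g⁻¹ = xj := by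
          calc _ = (g * xj * g⁻¹) * (g * xk * g⁻¹) * (g * xj * g⁻¹)⁻¹ := by group
            _ = _ := by rw [h1, h2]; group
        have h4 : a⁻¹ * (xj * xk * xj⁻¹) * a = (xi * xj * xi⁻¹) * xk * (xi * xj * xi⁻¹)⁻¹ := by
          calc _ = (a⁻¹ * xj * a) * (a⁻¹ * xk * a) * (a⁻¹ * xj * a)⁻¹ := by group
            _ = _ := by rw [c1, h0]
        conv_lhs => rw [← h3, key, h4]
        calc _ = (g * xi * g⁻¹) * (g * xj * g⁻¹) * (g * xi * g⁻¹)⁻¹ * (g * xk * g⁻¹) *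
              (g * xi * g⁻¹) * (g * xj * g⁻¹)⁻¹ * (g * xi * g⁻¹)⁻¹ := by group
          _ = _ := by rw [hi, h1, h2]; group
      · have hr' : g * pureElt N r s * g⁻¹ = pureElt N r s := by
          rw [mul_inv_eq_iff_eq_mul, ← hg]
          exact (sigma_commute_pureElt (by omega) hs (by omega) (by omega) (by omega)
            (by omega)).eq
        have c := c3 r (by omega) (by omega)
        generalize pureElt N r s = xr at *
        conv_lhs => rw [← hr', key, c]
        calc _ = (g * xi * g⁻¹) * (g * xj * g⁻¹) * (g * xi * g⁻¹)⁻¹ * (g * xj * g⁻¹)⁻¹ *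
              (g * xr * g⁻¹) * (g * xj * g⁻¹) * (g * xi * g⁻¹) * (g * xj * g⁻¹)⁻¹ *
              (g * xi * g⁻¹)⁻¹ := by group
          _ = _ := by rw [hi, h1, hr']

/-! ### Artin's action on the free group -/

/-- The free generator `x_i` of the free group of rank `N` (and `1` outside the range). -/
def freeElt (N i : ℕ) : FreeGroup (Fin N) :=
  if h : i < N then FreeGroup.of ⟨i, h⟩ else 1

theorem freeElt_val {N : ℕ} (i : Fin N) : freeElt N i = FreeGroup.of i := dif_pos i.2

theorem freeGroup_hom_ext {N : ℕ} {M : Type*} [Monoid M] {f g : FreeGroup (Fin N) →* M}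
    (h : ∀ i, i < N → f (freeElt N i) = g (freeElt N i)) : f = g :=
  FreeGroup.ext_hom _ _ fun i => by simpa only [freeElt_val] using h i i.2

/-- The action of a generator of the braid group on the free group, as an endomorphism. -/
def artinHom {N : ℕ} (k : ℕ) : FreeGroup (Fin N) →* FreeGroup (Fin N) :=
  FreeGroup.lift fun i =>
    if (i : ℕ) = k then freeElt N (k + 1)
    else if (i : ℕ) = k + 1 then (freeElt N (k + 1))⁻¹ * freeElt N k * freeElt N (k + 1)
    else freeElt N i

/-- The inverse of `artinHom`. -/
def artinHomInv {N : ℕ} (k : ℕ) : FreeGroup (Fin N) →* FreeGroup (Fin N) :=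
  FreeGroup.lift fun i =>
    if (i : ℕ) = k then freeElt N k * freeElt N (k + 1) * (freeElt N k)⁻¹
    else if (i : ℕ) = k + 1 then freeElt N k
    else freeElt N i

theorem artinHom_freeElt {N : ℕ} (k i : ℕ) (hi : i < N) :
    artinHom k (freeElt N i) = if i = k then freeElt N (k + 1)
      else if i = k + 1 then (freeElt N (k + 1))⁻¹ * freeElt N k * freeElt N (k + 1)
      else freeElt N i := by
  rw [show freeElt N i = FreeGroup.of ⟨i, hi⟩ from dif_pos hi, artinHom, FreeGroup.lift_apply_of,
    ← show freeElt N i = FreeGroup.of ⟨i, hi⟩ from dif_pos hi]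

theorem artinHomInv_freeElt {N : ℕ} (k i : ℕ) (hi : i < N) :
    artinHomInv k (freeElt N i) =
      if i = k then freeElt N k * freeElt N (k + 1) * (freeElt N k)⁻¹
      else if i = k + 1 then freeElt N k else freeElt N i := by
  rw [show freeElt N i = FreeGroup.of ⟨i, hi⟩ from dif_pos hi, artinHomInv,
    FreeGroup.lift_apply_of, ← show freeElt N i = FreeGroup.of ⟨i, hi⟩ from dif_pos hi]

theorem artinHom_left {N : ℕ} (k : ℕ) (hk : k + 1 < N) :
    artinHom k (freeElt N k) = freeElt N (k + 1) := by
  rw [artinHom_freeElt _ _ (by omega), if_pos rfl]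

theorem artinHom_right {N : ℕ} (k : ℕ) (hk : k + 1 < N) :
    artinHom k (freeElt N (k + 1)) =
    (freeElt N (k + 1))⁻¹ * freeElt N k * freeElt N (k + 1) := by
  rw [artinHom_freeElt _ _ (by omega), if_neg (by omega), if_pos rfl]

theorem artinHomInv_left {N : ℕ} (k : ℕ) (hk : k + 1 < N) :
    artinHomInv k (freeElt N k) =
    freeElt N k * freeElt N (k + 1) * (freeElt N k)⁻¹ := by
  rw [artinHomInv_freeElt _ _ (by omega), if_pos rfl]

theorem artinHomInv_right {N : ℕ} (k : ℕ) (hk : k + 1 < N) :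
    artinHomInv k (freeElt N (k + 1)) = freeElt N k := by
  rw [artinHomInv_freeElt _ _ (by omega), if_neg (by omega), if_pos rfl]

theorem artinHom_of_ne {N : ℕ} (k i : ℕ) (h1 : i ≠ k) (h2 : i ≠ k + 1) :
    artinHom k (freeElt N i) = freeElt N i := by
  by_cases hi : i < N
  · rw [artinHom_freeElt _ _ hi, if_neg h1, if_neg h2]
  · rw [freeElt, dif_neg hi, map_one]

theorem artinHomInv_of_ne {N : ℕ} (k i : ℕ) (h1 : i ≠ k) (h2 : i ≠ k + 1) :
    artinHomInv k (freeElt N i) = freeElt N i := by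
  by_cases hi : i < N
  · rw [artinHomInv_freeElt _ _ hi, if_neg h1, if_neg h2]
  · rw [freeElt, dif_neg hi, map_one]

/-- The automorphism of the free group given by a generator of the braid group. -/
def artinAut {N : ℕ} (k : Fin (N - 1)) : MulAut (FreeGroup (Fin N)) :=
  MonoidHom.toMulEquiv (artinHom k) (artinHomInv k)
    (freeGroup_hom_ext fun i hi => by
      have hk : (k : ℕ) + 1 < N := by omega
      simp only [MonoidHom.comp_apply, MonoidHom.id_apply]
      by_cases h1 : i = k
      · rw [h1, artinHom_left _ hk, artinHomInv_right _ hk]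
      by_cases h2 : i = k + 1
      · rw [h2, artinHom_right _ hk]
        simp only [map_mul, map_inv, artinHomInv_right _ hk, artinHomInv_left _ hk]
        group
      rw [artinHom_of_ne _ _ h1 h2, artinHomInv_of_ne _ _ h1 h2])
    (freeGroup_hom_ext fun i hi => by
      have hk : (k : ℕ) + 1 < N := by omega
      simp only [MonoidHom.comp_apply, MonoidHom.id_apply]
      by_cases h1 : i = k
      · rw [h1, artinHomInv_left _ hk]
        simp only [map_mul, map_inv, artinHom_right _ hk, artinHom_left _ hk]
        group
      by_cases h2 : i = k + 1
      · rw [h2, artinHomInv_right _ hk, artinHom_left _ hk]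
      rw [artinHomInv_of_ne _ _ h1 h2, artinHom_of_ne _ _ h1 h2])

theorem artinAut_apply {N : ℕ} (k : Fin (N - 1)) (x : FreeGroup (Fin N)) :
    artinAut k x = artinHom k x := rfl

theorem mulAut_ext {N : ℕ} {f g : MulAut (FreeGroup (Fin N))}
    (h : ∀ i, i < N → f (freeElt N i) = g (freeElt N i)) : f = g :=
  MulEquiv.toMonoidHom_injective (freeGroup_hom_ext h)

theorem artinAut_comm {N : ℕ} (k l : Fin (N - 1)) (h : (k : ℕ) + 2 ≤ l) :
    artinAut k * artinAut l = artinAut l * artinAut k := by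
  refine mulAut_ext fun i hi => ?_
  have hk : (k : ℕ) + 1 < N := by omega
  have hl : (l : ℕ) + 1 < N := by omega
  simp only [MulAut.mul_apply, artinAut_apply]
  by_cases h1 : i = k
  · rw [h1, artinHom_left _ hk, artinHom_of_ne _ _ (by omega) (by omega), artinHom_left _ hk,
      artinHom_of_ne _ _ (by omega) (by omega)]
  by_cases h2 : i = k + 1
  · rw [h2, artinHom_right _ hk, artinHom_of_ne _ _ (by omega) (by omega), artinHom_right _ hk]
    simp only [map_mul, map_inv]
    rw [artinHom_of_ne _ _ (by omega) (by omega), artinHom_of_ne _ _ (by omega) (by omega)]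
  rw [artinHom_of_ne _ _ h1 h2]
  by_cases h3 : i = l
  · rw [h3, artinHom_left _ hl, artinHom_of_ne _ _ (by omega) (by omega)]
  by_cases h4 : i = l + 1
  · rw [h4, artinHom_right _ hl]
    simp only [map_mul, map_inv]
    rw [artinHom_of_ne _ _ (by omega) (by omega), artinHom_of_ne _ _ (by omega) (by omega)]
  rw [artinHom_of_ne _ _ h3 h4, artinHom_of_ne _ _ h1 h2]

theorem artinAut_braid {N : ℕ} (k l : Fin (N - 1)) (h : (k : ℕ) + 1 = l) :
    artinAut k * artinAut l * artinAut k = artinAut l * artinAut k * artinAut l := by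
  refine mulAut_ext fun i hi => ?_
  have hk : (k : ℕ) + 1 < N := by omega
  have hl : (k : ℕ) + 1 + 1 < N := by omega
  simp only [MulAut.mul_apply, artinAut_apply, ← h]
  have e1 := artinHom_left _ hk
  have e2 := artinHom_right _ hk
  have e3 := artinHom_of_ne (N := N) k (k + 1 + 1) (by omega) (by omega)
  have f1 := artinHom_left _ hl
  have f2 := artinHom_right _ hl
  have f3 := artinHom_of_ne (N := N) (k + 1) k (by omega) (by omega)
  by_cases h1 : i = k
  · rw [h1]
    simp only [e1, e3, f1, f3]
  by_cases h2 : i = k + 1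
  · rw [h2]
    simp only [map_mul, map_inv, e1, e2, e3, f1, f2, f3]
  by_cases h3 : i = k + 1 + 1
  · rw [h3]
    simp only [map_mul, map_inv, e2, e3, f1, f2, f3]
    group
  simp only [artinHom_of_ne _ _ h1 h2, artinHom_of_ne _ _ h2 h3]

/-- The Artin action of the braid group on the free group. -/
def artin (N : ℕ) : BraidGroup N →* MulAut (FreeGroup (Fin N)) :=
  braidLift artinAut artinAut_comm artinAut_braid

theorem braidLift_sigma {N : ℕ} {G : Type*} [Group G] (f : Fin (N - 1) → G) (hc hb)
    (k : ℕ) (hk : k + 1 < N) : braidLift f hc hb (sigma N k) = f ⟨k, by omega⟩ := by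
  rw [sigma, dif_pos hk]
  exact PresentedGroup.toGroup.of _

theorem sigma_of_le {N k : ℕ} (h : N ≤ k + 1) : sigma N k = 1 := dif_neg (by omega)

/-- A property of braids that holds for the generators and is closed under the group operations
holds for all braids. -/
theorem braid_induction {N : ℕ} {p : BraidGroup N → Prop}
    (hs : ∀ k, k + 1 < N → p (sigma N k)) (h1 : p 1) (hm : ∀ x y, p x → p y → p (x * y))
    (hi : ∀ x, p x → p x⁻¹) (x : BraidGroup N) : p x := by
  have hx : x ∈ Subgroup.closure (Set.range (PresentedGroup.of (rels := {r | BraidRel N r}))) := by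
    rw [PresentedGroup.closure_range_of]; trivial
  induction hx using Subgroup.closure_induction with
  | mem x hx =>
    obtain ⟨k, rfl⟩ := hx
    have hk := k.2
    have := hs k (by omega)
    rwa [sigma, dif_pos (by omega)] at this
  | one => exact h1
  | mul x y _ _ hx hy => exact hm x y hx hy
  | inv x _ hx => exact hi x hx

theorem artin_sigma {N k : ℕ} (hk : k + 1 < N) (x : FreeGroup (Fin N)) :
    artin N (sigma N k) x = artinHom k x := by
  rw [artin, braidLift_sigma _ _ _ k hk]; rfl

theorem addStrand_sigma {N k : ℕ} (hk : k + 1 < N) :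
    addStrand N (sigma N k) = sigma (N + 1) k := by
  rw [addStrand, braidLift_sigma _ _ _ k hk]

/-- Adding a trivial last strand fixes the `a_{ij}`. -/
theorem addStrand_pureElt {N i j : ℕ} (hij : i < j) (hj : j < N) :
    addStrand N (pureElt N i j) = pureElt (N + 1) i j := by
  induction j, hij using Nat.le_induction with
  | base => rw [pureElt_self_succ, pureElt_self_succ, map_pow, addStrand_sigma hj]
  | succ j h ih =>
    rw [pureElt_succ N h, pureElt_succ _ h, map_mul, map_mul, map_inv, addStrand_sigma hj,
      ih (by omega)]

/-! ### The homomorphism F_N ⋊ B_N → B_{N+1} -/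

/-- The semidirect product of the free group and the braid group for the Artin action. -/
abbrev ArtinProduct (N : ℕ) : Type := FreeGroup (Fin N) ⋊[artin N] BraidGroup N

/-- The homomorphism from the free group that sends `x_i` to `a_{i,N+1}`. -/
def freeToBraid (N : ℕ) : FreeGroup (Fin N) →* BraidGroup (N + 1) :=
  FreeGroup.lift fun i => pureElt (N + 1) i N

theorem freeToBraid_freeElt {N i : ℕ} (hi : i < N) :
    freeToBraid N (freeElt N i) = pureElt (N + 1) i N := by
  rw [freeElt, dif_pos hi, freeToBraid, FreeGroup.lift_apply_of]

/-- On generators this is the conjugation formulas for σ_k; it is the compatibility that makes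
`comb` a homomorphism. -/
theorem freeToBraid_artin (N : ℕ) (b : BraidGroup N) (x : FreeGroup (Fin N)) :
    freeToBraid N (artin N b x) = addStrand N b * freeToBraid N x * (addStrand N b)⁻¹ := by
  induction b using braid_induction generalizing x with
  | hs k hk =>
    rw [artin_sigma hk, addStrand_sigma hk]
    refine DFunLike.congr_fun (f := (freeToBraid N).comp (artinHom k))
      (g := (MulAut.conj (sigma (N + 1) k)).toMonoidHom.comp (freeToBraid N))
      (freeGroup_hom_ext fun i hi => ?_) x
    change freeToBraid N (artinHom k (freeElt N i)) =
      sigma (N + 1) k * freeToBraid N (freeElt N i) * (sigma (N + 1) k)⁻¹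
    by_cases h1 : i = k
    · rw [h1, artinHom_left _ hk, freeToBraid_freeElt hk, freeToBraid_freeElt (by omega),
        sigma_conj_pureElt_left hk (by omega)]
    by_cases h2 : i = k + 1
    · rw [h2, artinHom_right _ hk]
      simp only [map_mul, map_inv]
      rw [freeToBraid_freeElt hk, freeToBraid_freeElt (by omega),
        sigma_conj_pureElt_right hk (by omega)]
    rw [artinHom_of_ne _ _ h1 h2, freeToBraid_freeElt hi, eq_mul_inv_iff_mul_eq]
    exact (sigma_commute_pureElt hi (by omega) (by omega) (by omega) (by omega) (by omega)).eq.symm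
  | h1 => simp
  | hm a b ha hb => rw [map_mul, MulAut.mul_apply, ha, hb, map_mul]; group
  | hi a ha =>
    have := ha (artin N a⁻¹ x)
    rw [← MulAut.mul_apply, ← map_mul, mul_inv_cancel, map_one, MulAut.one_apply] at this
    rw [this, map_inv (addStrand N)]; group

/-- The homomorphism `F_N ⋊ B_N → B_{N+1}`. -/
def comb (N : ℕ) : ArtinProduct N →* BraidGroup (N + 1) :=
  SemidirectProduct.lift (freeToBraid N) (addStrand N) fun b => by
    ext1 i
    exact freeToBraid_artin N b _

theorem inr_mul_inl {N : ℕ} (b : BraidGroup N) (x : FreeGroup (Fin N)) :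
    (SemidirectProduct.inr b * SemidirectProduct.inl x : ArtinProduct N) =
      SemidirectProduct.inl (artin N b x) * SemidirectProduct.inr b := by
  rw [SemidirectProduct.inl_aut, map_inv, inv_mul_cancel_right]

theorem comb_inl {N : ℕ} (x : FreeGroup (Fin N)) :
    comb N (SemidirectProduct.inl x) = freeToBraid N x := SemidirectProduct.lift_inl ..

theorem comb_inr {N : ℕ} (b : BraidGroup N) :
    comb N (SemidirectProduct.inr b) = addStrand N b := SemidirectProduct.lift_inr ..

/-! ### Injectivity and image of `comb` by an induced action -/

/-- The element of `F_N ⋊ B_N` by which the crossing `k` acts on the coset of braids that take the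
last strand to position `p`. -/
def combCocycle (N k p : ℕ) : ArtinProduct N :=
  if k + 1 < p then SemidirectProduct.inr (sigma N k)
  else if k + 1 = p then SemidirectProduct.inl (freeElt N k)
  else if k = p then 1
  -- Here k > p, so the subtraction is genuine: deleting position p lowers the number of the
  -- crossing by one.
  else SemidirectProduct.inr (sigma N (k - 1))

theorem combCocycle_lt {N k p : ℕ} (h : k + 1 < p) :
    combCocycle N k p = SemidirectProduct.inr (sigma N k) := if_pos h

theorem combCocycle_succ (N k : ℕ) :
    combCocycle N k (k + 1) = SemidirectProduct.inl (freeElt N k) := by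
  rw [combCocycle, if_neg (by omega), if_pos rfl]

theorem combCocycle_self (N k : ℕ) : combCocycle N k k = 1 := by
  rw [combCocycle, if_neg (by omega), if_neg (by omega), if_pos rfl]

theorem combCocycle_gt {N k p : ℕ} (h : p < k + 1) :
    combCocycle N (k + 1) p = SemidirectProduct.inr (sigma N k) := by
  rw [combCocycle, if_neg (by omega), if_neg (by omega), if_neg (by omega), Nat.add_sub_cancel]

/-- The action of a generator of `B_{N+1}` on the set induced from the regular action of
`F_N ⋊ B_N`. -/
def combStep {N : ℕ} (k : Fin (N + 1 - 1)) : Equiv.Perm (Fin (N + 1) × ArtinProduct N) where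
  toFun x := (adjSwap k x.1, combCocycle N k x.1 * x.2)
  invFun x := (adjSwap k x.1, (combCocycle N k (adjSwap k x.1))⁻¹ * x.2)
  left_inv x := by simp [adjSwap]
  right_inv x := by simp [adjSwap]

theorem combStep_apply {N : ℕ} (k : Fin (N + 1 - 1)) (x : Fin (N + 1) × ArtinProduct N) :
    combStep k x = (adjSwap k x.1, combCocycle N k x.1 * x.2) := rfl

theorem inr_sigma_commute_inl {N k i : ℕ} (hk : k + 1 < N) (h1 : i ≠ k) (h2 : i ≠ k + 1) :
    (SemidirectProduct.inr (sigma N k) * SemidirectProduct.inl (freeElt N i) : ArtinProduct N) =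
      SemidirectProduct.inl (freeElt N i) * SemidirectProduct.inr (sigma N k) := by
  rw [inr_mul_inl, artin_sigma hk, artinHom_of_ne _ _ h1 h2]

theorem inr_sigma_mul_inl {N k : ℕ} (hk : k + 1 < N) :
    (SemidirectProduct.inr (sigma N k) * SemidirectProduct.inl (freeElt N k) : ArtinProduct N) =
      SemidirectProduct.inl (freeElt N (k + 1)) * SemidirectProduct.inr (sigma N k) := by
  rw [inr_mul_inl, artin_sigma hk, artinHom_left _ hk]

/-- Artin's automorphism for σ_k fixes the product x_k x_{k+1}. -/
theorem inr_sigma_mul_inl_mul_inl {N k : ℕ} (hk : k + 1 < N) :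
    (SemidirectProduct.inr (sigma N k) * SemidirectProduct.inl (freeElt N k) *
        SemidirectProduct.inl (freeElt N (k + 1)) : ArtinProduct N) =
      SemidirectProduct.inl (freeElt N k) * SemidirectProduct.inl (freeElt N (k + 1)) *
        SemidirectProduct.inr (sigma N k) := by
  rw [inr_sigma_mul_inl hk, mul_assoc, inr_mul_inl, artin_sigma hk, artinHom_right _ hk,
    ← mul_assoc, ← map_mul, ← map_mul]
  congr 2
  group

theorem inr_sigma_comm {N k l : ℕ} (h : k + 2 ≤ l) :
    (SemidirectProduct.inr (sigma N k) * SemidirectProduct.inr (sigma N l) : ArtinProduct N) =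
      SemidirectProduct.inr (sigma N l) * SemidirectProduct.inr (sigma N k) := by
  rw [← map_mul, ← map_mul, sigma_comm _ _ _ h]

theorem inr_sigma_braid {N k : ℕ} (h : k + 2 < N) :
    (SemidirectProduct.inr (sigma N k) * SemidirectProduct.inr (sigma N (k + 1)) *
        SemidirectProduct.inr (sigma N k) : ArtinProduct N) =
      SemidirectProduct.inr (sigma N (k + 1)) * SemidirectProduct.inr (sigma N k) *
        SemidirectProduct.inr (sigma N (k + 1)) := by
  rw [← map_mul, ← map_mul, sigma_braid _ _ h, map_mul, map_mul]

theorem combStep_comm {N : ℕ} (k l : Fin (N + 1 - 1)) (h : (k : ℕ) + 2 ≤ l) :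
    (combStep k * combStep l : Equiv.Perm (Fin (N + 1) × ArtinProduct N)) =
      combStep l * combStep k := by
  refine Equiv.ext fun ⟨p, g⟩ => Prod.ext ?_ ?_
  · exact DFunLike.congr_fun (adjSwap_comm k l h) p
  simp only [Equiv.Perm.mul_apply, combStep_apply, ← mul_assoc, adjSwap_apply]
  congr 1
  obtain ⟨k, hk⟩ := k
  obtain ⟨l, hl⟩ := l
  obtain ⟨p, hp⟩ := p
  dsimp only at h ⊢
  -- The form l' + 1 lets `combCocycle_gt` apply without truncated subtraction.
  obtain ⟨l, rfl⟩ : ∃ l', l = l' + 1 := ⟨l - 1, by omega⟩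
  rcases lt_trichotomy p k with h1 | rfl | h1
  · obtain ⟨k, rfl⟩ : ∃ k', k = k' + 1 := ⟨k - 1, by omega⟩
    rw [if_neg (by omega), if_neg (by omega), if_neg (by omega), if_neg (by omega),
      combCocycle_gt h1, combCocycle_gt (by omega), inr_sigma_comm (by omega)]
  · rw [if_neg (by omega), if_neg (by omega), if_pos rfl, combCocycle_self,
      combCocycle_gt (by omega), combCocycle_gt (by omega), one_mul, mul_one]
  obtain rfl | h1 : p = k + 1 ∨ k + 1 < p := by omega
  · rw [if_neg (by omega), if_neg (by omega), if_neg (by omega), if_pos rfl, combCocycle_succ,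
      combCocycle_gt (by omega), combCocycle_gt (by omega),
      inr_sigma_commute_inl (by omega) (by omega) (by omega)]
  rw [if_neg (show p ≠ k by omega), if_neg (show p ≠ k + 1 by omega), combCocycle_lt h1]
  rcases lt_trichotomy p (l + 1) with h2 | rfl | h2
  · rw [if_neg (by omega), if_neg (by omega), combCocycle_lt h1, combCocycle_gt (by omega),
      inr_sigma_comm (by omega)]
  · rw [if_pos rfl, combCocycle_self, combCocycle_lt (by omega), one_mul, mul_one]
  obtain rfl | h2 : p = l + 1 + 1 ∨ l + 1 + 1 < p := by omega
  · rw [if_neg (by omega), if_pos rfl, combCocycle_lt (by omega), combCocycle_succ,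
      inr_sigma_commute_inl (by omega) (by omega) (by omega)]
  · rw [if_neg (by omega), if_neg (by omega), combCocycle_lt h1, combCocycle_lt h2,
      inr_sigma_comm (by omega)]

/-- The position p of the last strand decides what is to be checked. For p < k or p > k + 2 it is a
braid relation in B_N; for p = k both sides are σ_k; for p = k + 1 it is σ_k x_k = x_{k+1} σ_k; for
p = k + 2 it is that σ_k commutes with x_k x_{k+1}. -/
theorem combStep_braid {N : ℕ} (k l : Fin (N + 1 - 1)) (h : (k : ℕ) + 1 = l) :
    (combStep k * combStep l * combStep k : Equiv.Perm (Fin (N + 1) × ArtinProduct N)) =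
      combStep l * combStep k * combStep l := by
  refine Equiv.ext fun ⟨p, g⟩ => Prod.ext ?_ ?_
  · exact DFunLike.congr_fun (adjSwap_braid k l h) p
  simp only [Equiv.Perm.mul_apply, combStep_apply, ← mul_assoc, adjSwap_apply]
  congr 1
  obtain ⟨k, hk⟩ := k
  obtain ⟨l, hl⟩ := l
  obtain ⟨p, hp⟩ := p
  dsimp only at h ⊢
  subst h
  have n1 : ∀ a : ℕ, (a = a + 1) = False := fun a => by simp
  have n1' : ∀ a : ℕ, (a + 1 = a) = False := fun a => by simp
  have n2 : ∀ a : ℕ, (a = a + 1 + 1) = False := fun a => by simp; omega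
  have n2' : ∀ a : ℕ, (a + 1 + 1 = a) = False := fun a => by simp; omega
  rcases lt_trichotomy p k with h1 | rfl | h1
  · obtain ⟨k, rfl⟩ : ∃ k', k = k' + 1 := ⟨k - 1, by omega⟩
    simp only [if_neg (show p ≠ k + 1 by omega), if_neg (show p ≠ k + 1 + 1 by omega),
      if_neg (show p ≠ k + 1 + 1 + 1 by omega), combCocycle_gt h1,
      combCocycle_gt (show p < k + 1 + 1 by omega)]
    exact inr_sigma_braid (by omega)
  · simp only [n1 p, n2 p, n1 (p + 1), if_true, if_false, combCocycle_self,
      combCocycle_gt (show p < p + 1 by omega), combCocycle_lt (show p + 1 < p + 1 + 1 by omega),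
      one_mul, mul_one]
  obtain rfl | h1 : p = k + 1 ∨ k + 1 < p := by omega
  · simp only [n1' k, n1 k, n2 k, n2' k, n1 (k + 1), n1' (k + 1), if_true, if_false,
      combCocycle_self, combCocycle_succ, combCocycle_gt (show k < k + 1 by omega),
      combCocycle_lt (show k + 1 < k + 1 + 1 by omega), one_mul, mul_one]
    exact inr_sigma_mul_inl (by omega)
  obtain rfl | h1 : p = k + 1 + 1 ∨ k + 1 + 1 < p := by omega
  · simp only [n1' k, n2' k, n1' (k + 1), if_true, if_false,
      combCocycle_succ, combCocycle_gt (show k < k + 1 by omega),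
      combCocycle_lt (show k + 1 < k + 1 + 1 by omega)]
    exact (inr_sigma_mul_inl_mul_inl (by omega)).symm
  · simp only [if_neg (show p ≠ k by omega), if_neg (show p ≠ k + 1 by omega),
      if_neg (show p ≠ k + 1 + 1 by omega), combCocycle_lt h1,
      combCocycle_lt (show k + 1 < p by omega)]
    exact inr_sigma_braid (by omega)

/-- The action of `B_{N+1}` induced from the regular action of `F_N ⋊ B_N`. -/
def combAction (N : ℕ) : BraidGroup (N + 1) →* Equiv.Perm (Fin (N + 1) × ArtinProduct N) :=
  braidLift combStep combStep_comm combStep_braid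

theorem combAction_sigma {N k : ℕ} (hk : k < N) (x : Fin (N + 1) × ArtinProduct N) :
    combAction N (sigma (N + 1) k) x =
      (adjSwap ⟨k, by omega⟩ x.1, combCocycle N k x.1 * x.2) := by
  rw [combAction, braidLift_sigma _ _ _ k (by omega), combStep_apply]

theorem combAction_fst {N : ℕ} (b : BraidGroup (N + 1)) (x : Fin (N + 1) × ArtinProduct N) :
    (combAction N b x).1 = braidPerm (N + 1) b x.1 := by
  induction b using braid_induction generalizing x with
  | hs k hk =>
    rw [combAction_sigma (by omega), braidPerm, braidLift_sigma _ _ _ k hk]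
  | h1 => simp
  | hm a b ha hb => rw [map_mul, map_mul, Equiv.Perm.mul_apply, Equiv.Perm.mul_apply, ha, hb]
  | hi a ha =>
    rw [map_inv (braidPerm _), Equiv.Perm.eq_inv_iff_eq, ← ha, ← Equiv.Perm.mul_apply, ← map_mul,
      mul_inv_cancel, map_one, Equiv.Perm.one_apply]

/-- The inverse of `σ_{N-1} ⋯ σ_p`, which brings the last strand to position `p`. -/
def cosetRep (N p : ℕ) : BraidGroup (N + 1) :=
  ((List.Ico p N).reverse.map (sigma (N + 1))).prod⁻¹

theorem cosetRep_self (N : ℕ) : cosetRep N N = 1 := by simp [cosetRep]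

theorem cosetRep_of_lt {N p : ℕ} (h : p < N) :
    cosetRep N p = (sigma (N + 1) p)⁻¹ * cosetRep N (p + 1) := by
  simp [cosetRep, List.Ico.eq_cons h]

theorem pureElt_eq_cosetRep {N i : ℕ} : pureElt (N + 1) i N =
    (cosetRep N (i + 1))⁻¹ * sigma (N + 1) i ^ 2 * cosetRep N (i + 1) := by
  simp [pureElt, cosetRep]

theorem commute_cosetRep {N p : ℕ} {x : BraidGroup (N + 1)}
    (h : ∀ k, p ≤ k → k < N → Commute x (sigma (N + 1) k)) : Commute x (cosetRep N p) := by
  refine Commute.inv_right (Commute.list_prod_right _ _ fun y hy => ?_)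
  simp only [List.mem_map, List.mem_reverse, List.Ico.mem] at hy
  obtain ⟨k, hk, rfl⟩ := hy
  exact h k hk.1 hk.2

/-- The braid relation in the form σ_{k+1} σ_k⁻¹ σ_{k+1}⁻¹ = σ_k⁻¹ σ_{k+1}⁻¹ σ_k does the case p =
k; the factors that precede it for smaller p commute with σ_{k+1}. -/
theorem sigma_mul_cosetRep_gt {N k p : ℕ} (hk : k + 1 < N) (hp : p < k + 1) :
    sigma (N + 1) (k + 1) * cosetRep N p = cosetRep N p * sigma (N + 1) k := by
  induction (show p ≤ k by omega) using Nat.decreasingInduction with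
  | self =>
    have hb := sigma_braid (N + 1) k (by omega)
    have hc : Commute (sigma (N + 1) k) (cosetRep N (k + 1 + 1)) :=
      commute_cosetRep fun l _ _ => sigma_commute _ _ _ (by omega)
    rw [cosetRep_of_lt (by omega), cosetRep_of_lt hk, mul_assoc, mul_assoc, ← hc.eq]
    simp only [← mul_assoc]
    congr 1
    rw [mul_inv_eq_iff_eq_mul, mul_inv_eq_iff_eq_mul]
    calc _ = (sigma (N + 1) k)⁻¹ * (sigma (N + 1) (k + 1))⁻¹ *
          (sigma (N + 1) (k + 1) * sigma (N + 1) k * sigma (N + 1) (k + 1)) := by group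
      _ = _ := by rw [← hb]; group
  | of_succ p h ih =>
    have hc := sigma_commute (N + 1) (k + 1) p (by omega)
    rw [cosetRep_of_lt (by omega), ← mul_assoc, hc.inv_right.eq, mul_assoc, ih (by omega),
      mul_assoc]

/-- The source of the values of `combCocycle`: they are what remains of σ_k between the coset
representatives of p and of its new position. For p = k + 1 this is a conjugate of σ_k², namely the
image of x_k. -/
theorem comb_combCocycle {N k p : ℕ} (hk : k < N) (hp : p < N + 1) :
    sigma (N + 1) k * cosetRep N p =
      cosetRep N (if p = k then k + 1 else if p = k + 1 then k else p) *
        comb N (combCocycle N k p) := by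
  rcases lt_trichotomy p k with h1 | rfl | h1
  · obtain ⟨k, rfl⟩ : ∃ k', k = k' + 1 := ⟨k - 1, by omega⟩
    rw [if_neg (by omega), if_neg (by omega), combCocycle_gt h1, comb_inr,
      addStrand_sigma (by omega), sigma_mul_cosetRep_gt hk h1]
  · rw [if_pos rfl, combCocycle_self, map_one, mul_one, cosetRep_of_lt hk, mul_inv_cancel_left]
  obtain rfl | h1 : p = k + 1 ∨ k + 1 < p := by omega
  · rw [if_neg (by omega), if_pos rfl, combCocycle_succ, comb_inl, freeToBraid_freeElt hk,
      pureElt_eq_cosetRep, cosetRep_of_lt hk]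
    simp only [pow_two, mul_assoc, inv_mul_cancel_left, mul_inv_cancel_left]
  · rw [if_neg (by omega), if_neg (by omega), combCocycle_lt h1, comb_inr,
      addStrand_sigma (by omega)]
    exact commute_cosetRep fun l _ _ => sigma_commute _ _ _ (by omega)

/-- The map (p, g) ↦ `cosetRep N p * comb N g` intertwines `combAction` with left multiplication. At
the base point it shows that a braid fixing the last position lies in the image of `comb`. -/
theorem combAction_snd {N : ℕ} (b : BraidGroup (N + 1)) (x : Fin (N + 1) × ArtinProduct N) :
    b * (cosetRep N x.1 * comb N x.2) =
      cosetRep N (combAction N b x).1 * comb N (combAction N b x).2 := by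
  induction b using braid_induction generalizing x with
  | hs k hk =>
    rw [combAction_sigma (by omega)]
    dsimp only
    rw [adjSwap_apply, map_mul, ← mul_assoc, ← mul_assoc, comb_combCocycle (by omega) x.1.2]
  | h1 => simp
  | hm a b ha hb => rw [map_mul, Equiv.Perm.mul_apply, mul_assoc, hb, ha]
  | hi a ha =>
    rw [inv_mul_eq_iff_eq_mul, ha, ← Equiv.Perm.mul_apply, ← map_mul, mul_inv_cancel, map_one,
      Equiv.Perm.one_apply]

/-- The coset representative brings the last position to position `p`. -/
theorem combAction_cosetRep {N p : ℕ} (hp : p < N + 1) (g : ArtinProduct N) :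
    combAction N (cosetRep N p) (Fin.last N, g) = (⟨p, hp⟩, g) := by
  induction (show p ≤ N by omega) using Nat.decreasingInduction with
  | self => rw [cosetRep_self, map_one]; rfl
  | of_succ p h ih =>
    rw [cosetRep_of_lt h, map_mul, map_inv, Equiv.Perm.mul_apply, ih (by omega),
      Equiv.Perm.inv_eq_iff_eq, combAction_sigma h]
    refine Prod.ext (Fin.ext ?_) ?_
    · simp [adjSwap_apply]
    · simp [combCocycle_self]

/-- The fibre over the last position carries the regular action of F_N ⋊ B_N, so the image of its
identity recovers h. The claim is closed under products and inverses, which leaves the x_i and the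
σ_k. -/
theorem combAction_comb {N : ℕ} (h g : ArtinProduct N) :
    combAction N (comb N h) (Fin.last N, g) = (Fin.last N, h * g) := by
  have hinv : ∀ h : ArtinProduct N,
      (∀ g, combAction N (comb N h) (Fin.last N, g) = (Fin.last N, h * g)) →
      ∀ g, combAction N (comb N h⁻¹) (Fin.last N, g) = (Fin.last N, h⁻¹ * g) := by
    intro h hh g
    rw [map_inv, map_inv, Equiv.Perm.inv_eq_iff_eq, hh, mul_inv_cancel_left]
  have hmul : ∀ h h' : ArtinProduct N,
      (∀ g, combAction N (comb N h) (Fin.last N, g) = (Fin.last N, h * g)) →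
      (∀ g, combAction N (comb N h') (Fin.last N, g) = (Fin.last N, h' * g)) →
      ∀ g, combAction N (comb N (h * h')) (Fin.last N, g) = (Fin.last N, h * h' * g) := by
    intro h h' hh hh' g
    rw [map_mul, map_mul, Equiv.Perm.mul_apply, hh', hh, mul_assoc]
  rw [← SemidirectProduct.inl_left_mul_inr_right h]
  refine hmul _ _ ?_ ?_ g
  · induction h.left using FreeGroup.induction_on with
    | C1 => simp
    | of i =>
      intro g
      rw [comb_inl, ← freeElt_val, freeToBraid_freeElt i.2, pureElt_eq_cosetRep]
      simp only [map_mul, map_inv, pow_two, Equiv.Perm.mul_apply]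
      rw [combAction_cosetRep (by omega), Equiv.Perm.inv_eq_iff_eq,
        combAction_cosetRep (by omega), combAction_sigma i.2, combAction_sigma i.2]
      refine Prod.ext (Fin.ext ?_) ?_
      · simp [adjSwap_apply]
      · simp [adjSwap_apply, combCocycle_self, combCocycle_succ]
    | inv_of i hi => rw [map_inv]; exact hinv _ hi
    | mul x y hx hy => rw [map_mul]; exact hmul _ _ hx hy
  · induction h.right using braid_induction with
    | hs k hk =>
      intro g
      rw [comb_inr, addStrand_sigma hk, combAction_sigma (by omega)]
      refine Prod.ext (Fin.ext ?_) ?_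
      · simp only [adjSwap_apply, Fin.val_last]
        rw [if_neg (by omega), if_neg (by omega)]
      · simp only [Fin.val_last, combCocycle_lt hk]
    | h1 => simp
    | hi b hb => rw [map_inv]; exact hinv _ hb
    | hm x y hx hy => rw [map_mul]; exact hmul _ _ hx hy

theorem comb_injective (N : ℕ) : Function.Injective (comb N) := by
  rw [injective_iff_map_eq_one]
  intro h hh
  have := combAction_comb h 1
  rw [hh, map_one, mul_one] at this
  exact (congrArg Prod.snd this).symm

/-- The image of `F_N ⋊ B_N` consists of the braids whose last strand ends at the last position. -/
theorem mem_range_comb {N : ℕ} {b : BraidGroup (N + 1)} :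
    b ∈ (comb N).range ↔ braidPerm (N + 1) b (Fin.last N) = Fin.last N := by
  constructor
  · rintro ⟨h, rfl⟩
    have := combAction_fst (comb N h) (Fin.last N, 1)
    rw [combAction_comb] at this
    exact this.symm
  · intro hb
    have h1 := combAction_fst b (Fin.last N, 1)
    have h2 := combAction_snd b (Fin.last N, 1)
    rw [h1] at h2
    dsimp only at h2
    rw [hb, Fin.val_last, cosetRep_self, one_mul, one_mul, map_one, mul_one] at h2
    exact ⟨_, h2.symm⟩

/-! ### Erasing strands, adding strands, and membership in P_{m,n} -/

theorem positions_ext {N m : ℕ} {S T : Positions N m} (h : ∀ x, occ S x ↔ occ T x) : S = T := by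
  refine Subtype.ext (Finset.ext fun y => ?_)
  have := h y
  simpa [occ] using this

/-- Regard chosen positions among `N` as chosen positions among `N + 1`. -/
def extendPos {N m : ℕ} (S : Positions N m) : Positions (N + 1) m :=
  ⟨S.1.map Fin.castSuccEmb, by rw [Finset.card_map, S.2]⟩

theorem occ_extendPos {N m : ℕ} (S : Positions N m) (x : ℕ) : occ (extendPos S) x ↔ occ S x := by
  simp only [occ, extendPos, Finset.mem_map]
  constructor
  · rintro ⟨h, y, hy, e⟩
    obtain rfl : (y : ℕ) = x := congrArg Fin.val e
    exact ⟨y.2, hy⟩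
  · rintro ⟨h, hx⟩
    exact ⟨by omega, _, hx, rfl⟩

theorem rank_zero {N m : ℕ} (S : Positions N m) : rank S 0 = 0 := by simp [rank]

theorem rank_extendPos {N m : ℕ} (S : Positions N m) (x : ℕ) : rank (extendPos S) x = rank S x := by
  classical
  induction x with
  | zero => rw [rank_zero, rank_zero]
  | succ x ih => rw [rank_succ, rank_succ, ih, if_congr (occ_extendPos S x) rfl rfl]

theorem movePos_extendPos {N m : ℕ} (k : ℕ) (hk : k + 1 < N) (S : Positions N m) :
    movePos ⟨k, by omega⟩ (extendPos S) = extendPos (movePos ⟨k, by omega⟩ S) :=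
  positions_ext fun x => by rw [occ_movePos, occ_extendPos, occ_extendPos, occ_movePos]

theorem restCrossing_extendPos {N m : ℕ} (k : ℕ) (hk : k + 1 < N) (S : Positions N m) :
    restCrossing ⟨k, by omega⟩ (extendPos S) = restCrossing ⟨k, by omega⟩ S := by
  classical
  rw [restCrossing_eq, restCrossing_eq, rank_extendPos]
  exact if_congr (and_congr (occ_extendPos _ _) (occ_extendPos _ _)) rfl rfl

theorem erase_sigma {N m k : ℕ} (hk : k + 1 < N) (x : Positions N m × BraidGroup m) :
    erase N m (sigma N k) x =
      (movePos ⟨k, by omega⟩ x.1, restCrossing ⟨k, by omega⟩ x.1 * x.2) := by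
  rw [erase, braidLift_sigma _ _ _ k hk]; rfl

/-- Erasing strands other than an added trivial strand. -/
theorem erase_addStrand {N m : ℕ} (b : BraidGroup N) (x : Positions N m × BraidGroup m) :
    erase (N + 1) m (addStrand N b) (extendPos x.1, x.2) =
      (extendPos (erase N m b x).1, (erase N m b x).2) := by
  induction b using braid_induction generalizing x with
  | hs k hk =>
    rw [addStrand_sigma hk, erase_sigma (by omega), erase_sigma hk]
    exact Prod.ext (movePos_extendPos k hk _)
      (congrArg (· * x.2) (restCrossing_extendPos k hk x.1))
  | h1 => simp
  | hm a b ha hb => simp only [map_mul, Equiv.Perm.mul_apply, hb, ha]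
  | hi a ha =>
    rw [map_inv, map_inv, Equiv.Perm.inv_eq_iff_eq, ha, ← Equiv.Perm.mul_apply, ← map_mul,
      mul_inv_cancel, map_one, Equiv.Perm.one_apply]

theorem extendPos_injective {N m : ℕ} : Function.Injective (extendPos (N := N) (m := m)) :=
  fun S T h => positions_ext fun x => by rw [← occ_extendPos, h, occ_extendPos]

theorem occ_firstPositions {m n x : ℕ} : occ (firstPositions m n) x ↔ x < m := by
  simp only [occ, firstPositions, Finset.mem_map, Finset.mem_univ, true_and]
  constructor
  · rintro ⟨h, y, e⟩
    have : (y : ℕ) = x := congrArg Fin.val e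
    omega
  · intro h
    exact ⟨by omega, ⟨x, h⟩, rfl⟩

theorem extendPos_firstPositions (m k : ℕ) :
    extendPos (firstPositions m k) = firstPositions m (k + 1) :=
  positions_ext fun x => by rw [occ_extendPos, occ_firstPositions, occ_firstPositions]

theorem mem_mixedBraidGroup {m n : ℕ} {b : BraidGroup (m + n)} : b ∈ mixedBraidGroup m n ↔
    erase (m + n) m b (firstPositions m n, 1) = (firstPositions m n, 1) := Iff.rfl

theorem addStrand_mem_mixedBraidGroup {m k : ℕ} {b : BraidGroup (m + k)} :
    addStrand (m + k) b ∈ mixedBraidGroup m (k + 1) ↔ b ∈ mixedBraidGroup m k := by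
  have h := erase_addStrand b (firstPositions m k, (1 : BraidGroup m))
  rw [extendPos_firstPositions] at h
  rw [mem_mixedBraidGroup, mem_mixedBraidGroup]
  refine Iff.trans (Eq.congr h rfl) ?_
  rw [Prod.ext_iff, Prod.ext_iff, ← extendPos_firstPositions]
  exact and_congr extendPos_injective.eq_iff Iff.rfl

theorem braidPerm_addStrand {N : ℕ} (b : BraidGroup N) (x : Fin N) :
    braidPerm (N + 1) (addStrand N b) x.castSucc = (braidPerm N b x).castSucc := by
  induction b using braid_induction generalizing x with
  | hs k hk =>
    rw [addStrand_sigma hk, braidPerm, braidPerm, braidLift_sigma _ _ _ k hk,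
      braidLift_sigma _ _ _ k (by omega)]
    exact Fin.ext (by simp only [adjSwap_apply, Fin.val_castSucc])
  | h1 => simp
  | hm a b ha hb => simp only [map_mul, Equiv.Perm.mul_apply, hb, ha]
  | hi a ha =>
    rw [map_inv, map_inv, Equiv.Perm.inv_eq_iff_eq, ha, ← Equiv.Perm.mul_apply, ← map_mul,
      mul_inv_cancel, map_one, Equiv.Perm.one_apply]

theorem addStrand_mem_pureBraidGroup {N : ℕ} {b : BraidGroup N} :
    addStrand N b ∈ pureBraidGroup (N + 1) ↔ b ∈ pureBraidGroup N := by
  rw [pureBraidGroup, pureBraidGroup, MonoidHom.mem_ker, MonoidHom.mem_ker]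
  constructor
  · intro h
    ext1 x
    have := braidPerm_addStrand b x
    rw [h] at this
    exact (Fin.castSucc_injective _ this).symm
  · intro h
    ext1 x
    induction x using Fin.lastCases with
    | last =>
      -- The added strand ends where it starts because `addStrand` factors through `comb`.
      refine mem_range_comb.1 ⟨SemidirectProduct.inr b, comb_inr b⟩
    | cast x => rw [braidPerm_addStrand, h]; rfl

theorem sigma_sq_mem_pureBraidGroup (N k : ℕ) : sigma N k ^ 2 ∈ pureBraidGroup N := by
  by_cases hk : k + 1 < N
  · rw [pureBraidGroup, MonoidHom.mem_ker, map_pow, braidPerm, braidLift_sigma _ _ _ k hk, pow_two]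
    exact Equiv.swap_mul_self _ _
  · rw [sigma_of_le (by omega), one_pow]
    exact one_mem _

theorem pureElt_mem_pureBraidGroup (N i j : ℕ) : pureElt N i j ∈ pureBraidGroup N :=
  (MonoidHom.normal_ker (braidPerm N)).conj_mem _ (sigma_sq_mem_pureBraidGroup N i) _

/-- `cosetRep N p` carries the last strand to position p; if that strand is not among the chosen
ones, position p is empty afterwards. -/
theorem not_occ_erase_cosetRep {N m p : ℕ} (hp : p ≤ N)
    (x : Positions (N + 1) m × BraidGroup m) (hx : ¬ occ x.1 N) :
    ¬ occ (erase (N + 1) m (cosetRep N p) x).1 p := by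
  induction hp using Nat.decreasingInduction with
  | self => rwa [cosetRep_self, map_one]
  | of_succ p h ih =>
    rw [cosetRep_of_lt h, map_mul, map_inv, Equiv.Perm.mul_apply]
    generalize erase (N + 1) m (cosetRep N (p + 1)) x = y at *
    -- Writing y as an image under σ_p undoes the inverse crossing, so that `erase_sigma` applies.
    obtain ⟨z, rfl⟩ := (erase (N + 1) m (sigma (N + 1) p)).surjective y
    rw [← Equiv.Perm.mul_apply, inv_mul_cancel, Equiv.Perm.one_apply]
    rw [erase_sigma (by omega)] at ih
    rwa [occ_movePos_right ⟨p, by omega⟩] at ih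

/-- The generator is a conjugate of σ_i² by `cosetRep`, which puts the erased last strand at
position i + 1. Both crossings in σ_i² then involve that strand and leave nothing. -/
theorem pureElt_mem_mixedBraidGroup {m k i : ℕ} (hi : i < m + k) :
    pureElt (m + k + 1) i (m + k) ∈ mixedBraidGroup m (k + 1) := by
  rw [mem_mixedBraidGroup, pureElt_eq_cosetRep]
  simp only [map_mul, map_inv, Equiv.Perm.mul_apply]
  rw [Equiv.Perm.inv_eq_iff_eq]
  have h := not_occ_erase_cosetRep (show i + 1 ≤ m + k by omega)
    (firstPositions m (k + 1), (1 : BraidGroup m)) (by rw [occ_firstPositions]; omega)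
  generalize erase _ m (cosetRep (m + k) (i + 1)) (firstPositions m (k + 1), 1) = y at *
  rw [pow_two, map_mul, Equiv.Perm.mul_apply]
  change erase (m + k + 1) m _ (erase (m + k + 1) m _ y) = y
  rw [erase_sigma (by omega), erase_sigma (by omega),
    restCrossing_movePos, movePos_movePos, restCrossing_eq, if_neg (fun hh => h hh.2), one_mul,
    one_mul]

theorem freeToBraid_mem {m k : ℕ} (x : FreeGroup (Fin (m + k))) :
    freeToBraid (m + k) x ∈ pureMixedBraidGroup m (k + 1) := by
  induction x using FreeGroup.induction_on with
  | C1 => rw [map_one]; exact one_mem _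
  | of i =>
    rw [← freeElt_val, freeToBraid_freeElt i.2]
    exact ⟨pureElt_mem_mixedBraidGroup i.2, pureElt_mem_pureBraidGroup _ _ _⟩
  | inv_of i hi => rw [map_inv]; exact inv_mem hi
  | mul x y hx hy => rw [map_mul]; exact mul_mem hx hy

/-- The free factor already lies in P_{m,k+1}, so only the component in B_{m+k} matters. -/
theorem comb_mem_pureMixedBraidGroup {m k : ℕ} (g : ArtinProduct (m + k)) :
    comb (m + k) g ∈ pureMixedBraidGroup m (k + 1) ↔ g.right ∈ pureMixedBraidGroup m k := by
  conv_lhs => rw [← SemidirectProduct.inl_left_mul_inr_right g, map_mul, comb_inl, comb_inr]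
  rw [Subgroup.mul_mem_cancel_left _ (freeToBraid_mem _)]
  exact and_congr addStrand_mem_mixedBraidGroup addStrand_mem_pureBraidGroup

/-! ### Combing of P_{m,n} -/

/-- The homomorphism `F_N ⋊ H → B_{N+1}` induced by a homomorphism `H → B_N`. -/
def combMap {N : ℕ} {H : Type*} [Group H] (f : H →* BraidGroup N) :
    FreeGroup (Fin N) ⋊[(artin N).comp f] H →* BraidGroup (N + 1) :=
  (comb N).comp (SemidirectProduct.map (MonoidHom.id _) f fun _ => rfl)

theorem combMap_inl {N : ℕ} {H : Type*} [Group H] (f : H →* BraidGroup N)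
    (x : FreeGroup (Fin N)) : combMap f (SemidirectProduct.inl x) = freeToBraid N x := by
  rw [combMap, MonoidHom.comp_apply, SemidirectProduct.map_inl, comb_inl, MonoidHom.id_apply]

theorem combMap_inr {N : ℕ} {H : Type*} [Group H] (f : H →* BraidGroup N) (h : H) :
    combMap f (SemidirectProduct.inr h) = addStrand N (f h) := by
  rw [combMap, MonoidHom.comp_apply, SemidirectProduct.map_inr, comb_inr]

theorem combMap_injective {N : ℕ} {H : Type*} [Group H] {f : H →* BraidGroup N}
    (hf : Function.Injective f) : Function.Injective (combMap f) := by
  refine (comb_injective N).comp fun x y h => ?_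
  have h1 := congrArg SemidirectProduct.left h
  have h2 := congrArg SemidirectProduct.right h
  rw [SemidirectProduct.map_left, SemidirectProduct.map_left] at h1
  rw [SemidirectProduct.map_right, SemidirectProduct.map_right] at h2
  exact SemidirectProduct.ext h1 (hf h2)

/-- A pure braid fixes the last position, hence comes from `comb`. The map f is arbitrary so that
this serves both the inclusion of P_{m,k} and the map from the presented group. -/
theorem range_combMap {m k : ℕ} {H : Type*} [Group H] {f : H →* BraidGroup (m + k)}
    (hf : f.range = pureMixedBraidGroup m k) :
    (combMap f).range = pureMixedBraidGroup m (k + 1) := by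
  ext b
  constructor
  · rintro ⟨g, rfl⟩
    refine (comb_mem_pureMixedBraidGroup _).2 ?_
    rw [← hf]
    exact ⟨g.right, rfl⟩
  · intro hb
    have h1 : braidPerm (m + k + 1) b = 1 := hb.2
    obtain ⟨g, rfl⟩ := mem_range_comb.2 (show braidPerm (m + k + 1) b (Fin.last _) = _ by
      rw [h1]; rfl)
    have h2 := (comb_mem_pureMixedBraidGroup g).1 hb
    rw [← hf] at h2
    obtain ⟨h, hh⟩ := h2
    exact ⟨⟨g.left, h⟩, congrArg (comb (m + k)) (SemidirectProduct.ext rfl hh)⟩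

theorem rank_eq_self {N : ℕ} (S : Positions N N) {x : ℕ} (hx : x ≤ N) : rank S x = x := by
  classical
  have hS : S.1 = Finset.univ := Finset.eq_univ_of_card _ (by rw [S.2, Fintype.card_fin])
  induction x with
  | zero => exact rank_zero S
  | succ x ih =>
    rw [rank_succ, ih (by omega), if_pos ⟨hx, by rw [hS]; exact Finset.mem_univ _⟩]

/-- Erasing no strand. -/
theorem erase_self_snd {N : ℕ} (b : BraidGroup N) (x : Positions N N × BraidGroup N) :
    (erase N N b x).2 = b * x.2 := by
  classical
  induction b using braid_induction generalizing x with
  | hs k hk =>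
    have hS : x.1.1 = Finset.univ := Finset.eq_univ_of_card _ (by rw [x.1.2, Fintype.card_fin])
    rw [erase_sigma hk]
    dsimp only
    rw [restCrossing, if_pos (by rw [hS]; exact ⟨Finset.mem_univ _, Finset.mem_univ _⟩),
      rank_eq_self _ (show k ≤ N by omega)]
  | h1 => simp
  | hm a b ha hb => rw [map_mul, Equiv.Perm.mul_apply, ha, hb, mul_assoc]
  | hi a ha =>
    rw [eq_inv_mul_iff_mul_eq, ← ha, ← Equiv.Perm.mul_apply, ← map_mul, mul_inv_cancel, map_one,
      Equiv.Perm.one_apply]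

/-- With no strand to erase, what is left of a braid is the braid itself. -/
theorem pureMixedBraidGroup_zero (m : ℕ) : pureMixedBraidGroup m 0 = ⊥ := by
  rw [eq_bot_iff]
  intro b hb
  have h := erase_self_snd (N := m) b (firstPositions m 0, 1)
  rw [mul_one] at h
  have h2 : erase m m b (firstPositions m 0, 1) = (firstPositions m 0, 1) := hb.1
  rw [h2] at h
  exact h.symm

/-! ### The presented group and its comparison with P_{m,n} -/

/-- The group presented by the pure braid relations. -/
abbrev PureBraidPresented (m n : ℕ) : Type := PresentedGroup (pureBraidRelators m n)

/-- The generator of `PureBraidPresented m n` that stands for `a_{ij}`. -/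
def presGen {m n : ℕ} (i j : Fin (m + n)) (h : i < j) (hm : m ≤ (j : ℕ)) :
    PureBraidPresented m n :=
  PresentedGroup.of ⟨(i, j), h, hm⟩

theorem lift_gen {m n : ℕ} {G : Type*} [Group G] (f : GenIndex m n → G) (i j : Fin (m + n))
    (h : i < j) (hm : m ≤ (j : ℕ)) : FreeGroup.lift f (gen i j h hm) = f ⟨(i, j), h, hm⟩ :=
  FreeGroup.lift_apply_of

/-- The relations hold in the presented group. -/
theorem mk_eq_mk {m n : ℕ} {u v : FreeGroup (GenIndex m n)} (h : PureBraidRel m n u v) :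
    PresentedGroup.mk (pureBraidRelators m n) u = PresentedGroup.mk _ v := by
  have := PresentedGroup.one_of_mem (rels := pureBraidRelators m n) ⟨u, v, h, rfl⟩
  rwa [map_mul, map_inv, mul_inv_eq_one] at this

/-- The homomorphism from the presented group determined by elements that satisfy the pure braid
relations. -/
def presLift {m n : ℕ} {G : Type*} [Group G] (f : GenIndex m n → G)
    (hf : ∀ u v, PureBraidRel m n u v → FreeGroup.lift f u = FreeGroup.lift f v) :
    PureBraidPresented m n →* G :=
  PresentedGroup.toGroup (f := f) (by
    rintro _ ⟨u, v, h, rfl⟩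
    rw [map_mul, map_inv, hf u v h, mul_inv_cancel])

theorem presLift_presGen {m n : ℕ} {G : Type*} [Group G] (f : GenIndex m n → G) (hf)
    (i j : Fin (m + n)) (h : i < j) (hm : m ≤ (j : ℕ)) :
    presLift f hf (presGen i j h hm) = f ⟨(i, j), h, hm⟩ := lift_gen f i j h hm

/-- The homomorphism from the presented group to the braid group. -/
def presHom (m n : ℕ) : PureBraidPresented m n →* BraidGroup (m + n) :=
  presLift (fun p => pureGen p.1.1 p.1.2) (by
    rintro _ _ (⟨i, j, r, s, hij, hrs, hj, hs, h⟩ | ⟨i, j, s, hij, hjs, his, hj, hs⟩ |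
      ⟨i, j, s, hij, hjs, his, hj, hs⟩ | ⟨i, r, j, s, hir, hrj, hij, hjs, his, hrs, hj, hs⟩) <;>
    simp only [map_mul, map_inv, lift_gen, pureGen_eq]
    · rw [mul_assoc, (pureElt_commute hij hrs s.2 h).eq, inv_mul_cancel_left]
    · exact (pureElt_conj hij hjs s.2).1
    · exact (pureElt_conj hij hjs s.2).2.1
    · exact (pureElt_conj hij hjs s.2).2.2 r hir hrj)

theorem presHom_presGen {m n : ℕ} (i j : Fin (m + n)) (h : i < j) (hm : m ≤ (j : ℕ)) :
    presHom m n (presGen i j h hm) = pureElt (m + n) i j :=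
  presLift_presGen _ _ i j h hm

/-- The homomorphism of presented groups that corresponds to adding a trivial strand. -/
def presAdd (m k : ℕ) : PureBraidPresented m k →* PureBraidPresented m (k + 1) :=
  presLift (fun p => presGen (n := k + 1) p.1.1.castSucc p.1.2.castSucc p.2.1 p.2.2) (by
    rintro _ _ (⟨i, j, r, s, hij, hrs, hj, hs, h⟩ | ⟨i, j, s, hij, hjs, his, hj, hs⟩ |
      ⟨i, j, s, hij, hjs, his, hj, hs⟩ | ⟨i, r, j, s, hir, hrj, hij, hjs, his, hrs, hj, hs⟩) <;>
    simp only [map_mul, map_inv, lift_gen]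
    · exact mk_eq_mk (PureBraidRel.P1 (n := k + 1) i.castSucc j.castSucc r.castSucc s.castSucc
        hij hrs hj hs h)
    · exact mk_eq_mk (PureBraidRel.P2 (n := k + 1) i.castSucc j.castSucc s.castSucc
        hij hjs his hj hs)
    · exact mk_eq_mk (PureBraidRel.P3 (n := k + 1) i.castSucc j.castSucc s.castSucc
        hij hjs his hj hs)
    · exact mk_eq_mk (PureBraidRel.P4 (n := k + 1) i.castSucc r.castSucc j.castSucc s.castSucc
        hir hrj hij hjs his hrs hj hs))

theorem presAdd_presGen {m k : ℕ} (i j : Fin (m + k)) (h : i < j) (hm : m ≤ (j : ℕ)) :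
    presAdd m k (presGen i j h hm) = presGen (n := k + 1) i.castSucc j.castSucc h hm :=
  presLift_presGen _ _ i j h hm

/-- The homomorphism `x_i ↦ a_{i,m+k+1}` to the presented group. -/
def presFree (m k : ℕ) : FreeGroup (Fin (m + k)) →* PureBraidPresented m (k + 1) :=
  FreeGroup.lift fun i =>
    presGen (n := k + 1) i.castSucc (Fin.last (m + k)) (Fin.castSucc_lt_last i)
      (Nat.le_add_right m k)

theorem presFree_of {m k : ℕ} (i : Fin (m + k)) : presFree m k (FreeGroup.of i) =
    presGen (n := k + 1) i.castSucc (Fin.last (m + k)) (Fin.castSucc_lt_last i)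
      (Nat.le_add_right m k) := FreeGroup.lift_apply_of

theorem presHom_presFree {m k : ℕ} (x : FreeGroup (Fin (m + k))) :
    presHom m (k + 1) (presFree m k x) = freeToBraid (m + k) x := by
  refine DFunLike.congr_fun (f := (presHom m (k + 1)).comp (presFree m k))
    (FreeGroup.ext_hom _ _ fun i => ?_) x
  rw [MonoidHom.comp_apply, presFree_of, presHom_presGen, ← freeElt_val, freeToBraid_freeElt i.2]
  rfl

theorem presGen_induction {m n : ℕ} {p : PureBraidPresented m n → Prop}
    (hs : ∀ i j h hm, p (presGen i j h hm)) (h1 : p 1) (hm : ∀ x y, p x → p y → p (x * y))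
    (hi : ∀ x, p x → p x⁻¹) (x : PureBraidPresented m n) : p x := by
  have hx : x ∈ Subgroup.closure
      (Set.range (PresentedGroup.of (rels := pureBraidRelators m n))) := by
    rw [PresentedGroup.closure_range_of]; trivial
  induction hx using Subgroup.closure_induction with
  | mem x hx => obtain ⟨q, rfl⟩ := hx; exact hs _ _ q.2.1 q.2.2
  | one => exact h1
  | mul x y _ _ hx hy => exact hm x y hx hy
  | inv x _ hx => exact hi x hx

theorem presHom_presAdd {m k : ℕ} (q : PureBraidPresented m k) :
    presHom m (k + 1) (presAdd m k q) = addStrand (m + k) (presHom m k q) := by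
  induction q using presGen_induction with
  | hs i j h hm =>
    rw [presAdd_presGen, presHom_presGen, presHom_presGen, addStrand_pureElt h j.2]; rfl
  | h1 => simp
  | hm x y hx hy => simp only [map_mul, hx, hy]
  | hi x hx => simp only [map_inv, hx]

/-- By the relations, the `a_{ij}` normalize the subgroup generated by the `a_{i,m+k+1}`. -/
theorem exists_presFree_eq_conj {m k : ℕ} (i j : Fin (m + k)) (h : i < j) (hm : m ≤ (j : ℕ))
    (r : Fin (m + k)) : ∃ w, presFree m k w = (presAdd m k (presGen i j h hm))⁻¹ *
      presFree m k (FreeGroup.of r) * presAdd m k (presGen i j h hm) := by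
  have hs : m ≤ ((Fin.last (m + k) : Fin (m + (k + 1))) : ℕ) := Nat.le_add_right m k
  have hl : ∀ a : Fin (m + k), (a.castSucc : Fin (m + (k + 1))) < Fin.last (m + k) :=
    fun a => Fin.castSucc_lt_last a
  rw [presAdd_presGen, presFree_of]
  have comm : j < r ∨ r < i → ∃ w, presFree m k w =
      (presGen (n := k + 1) i.castSucc j.castSucc h hm)⁻¹ *
        presGen (n := k + 1) r.castSucc (Fin.last (m + k)) (hl r) hs *
        presGen (n := k + 1) i.castSucc j.castSucc h hm := by
    intro hr
    refine ⟨FreeGroup.of r, ?_⟩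
    rw [presFree_of]
    exact (mk_eq_mk (PureBraidRel.P1 (n := k + 1) i.castSucc j.castSucc r.castSucc _ h (hl r) hm hs
      (hr.imp id fun h => ⟨h, hl j⟩))).symm
  -- The place of r relative to i and j selects one of the four relations; the witness is its
  -- right-hand side, read in the free group.
  rcases lt_trichotomy r i with h1 | rfl | h1
  · exact comm (Or.inr h1)
  · refine ⟨FreeGroup.of r * FreeGroup.of j * FreeGroup.of r * (FreeGroup.of j)⁻¹ *
      (FreeGroup.of r)⁻¹, ?_⟩
    simp only [map_mul, map_inv, presFree_of]
    exact (mk_eq_mk (PureBraidRel.P3 (n := k + 1) r.castSucc j.castSucc _ h (hl j) (hl r) hm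
      hs)).symm
  rcases lt_trichotomy r j with h2 | rfl | h2
  · refine ⟨FreeGroup.of i * FreeGroup.of j * (FreeGroup.of i)⁻¹ * (FreeGroup.of j)⁻¹ *
      FreeGroup.of r * FreeGroup.of j * FreeGroup.of i * (FreeGroup.of j)⁻¹ *
      (FreeGroup.of i)⁻¹, ?_⟩
    simp only [map_mul, map_inv, presFree_of]
    exact (mk_eq_mk (PureBraidRel.P4 (n := k + 1) i.castSucc r.castSucc j.castSucc _ h1 h2 h (hl j)
      (hl i) (hl r) hm hs)).symm
  · refine ⟨FreeGroup.of i * FreeGroup.of r * (FreeGroup.of i)⁻¹, ?_⟩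
    simp only [map_mul, map_inv, presFree_of]
    exact (mk_eq_mk (PureBraidRel.P2 (n := k + 1) i.castSucc r.castSucc _ h (hl r) (hl i) hm
      hs)).symm
  · exact comm (Or.inl h2)

theorem freeToBraid_injective (N : ℕ) : Function.Injective (freeToBraid N) := by
  have : ⇑(freeToBraid N) = comb N ∘ SemidirectProduct.inl := funext fun x => (comb_inl x).symm
  rw [this]
  exact (comb_injective N).comp SemidirectProduct.inl_injective

/-- The action by conjugation in the presented group is the Artin action. -/
theorem presFree_artin {m k : ℕ} (q : PureBraidPresented m k) (x : FreeGroup (Fin (m + k))) :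
    presFree m k (artin (m + k) (presHom m k q) x) =
      presAdd m k q * presFree m k x * (presAdd m k q)⁻¹ := by
  have hinv : ∀ q : PureBraidPresented m k,
      (∀ x, presFree m k (artin (m + k) (presHom m k q) x) =
        presAdd m k q * presFree m k x * (presAdd m k q)⁻¹) →
      ∀ x, presFree m k (artin (m + k) (presHom m k q⁻¹) x) =
        presAdd m k q⁻¹ * presFree m k x * (presAdd m k q⁻¹)⁻¹ := by
    intro q hq x
    have h := hq (artin (m + k) (presHom m k q⁻¹) x)
    rw [← MulAut.mul_apply, ← map_mul, ← map_mul, mul_inv_cancel, map_one, map_one,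
      MulAut.one_apply] at h
    rw [h, map_inv (presAdd m k)]
    group
  induction q using presGen_induction generalizing x with
  | hs i j h hm =>
    -- The relations describe conjugation a⁻¹ x a, so the inverse of a generator is treated first
    -- and `hinv` gives the generator.
    have key : ∀ x, presFree m k (artin (m + k) (presHom m k (presGen i j h hm)⁻¹) x) =
        presAdd m k (presGen i j h hm)⁻¹ * presFree m k x *
          (presAdd m k (presGen i j h hm)⁻¹)⁻¹ := by
      refine fun x => DFunLike.congr_fun
        (f := (presFree m k).comp
          (artin (m + k) (presHom m k (presGen i j h hm)⁻¹)).toMonoidHom)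
        (g := (MulAut.conj (presAdd m k (presGen i j h hm)⁻¹)).toMonoidHom.comp (presFree m k))
        (FreeGroup.ext_hom _ _ fun r => ?_) x
      change presFree m k (artin (m + k) (presHom m k (presGen i j h hm)⁻¹) (FreeGroup.of r)) =
        presAdd m k (presGen i j h hm)⁻¹ * presFree m k (FreeGroup.of r) *
          (presAdd m k (presGen i j h hm)⁻¹)⁻¹
      obtain ⟨w, hw⟩ := exists_presFree_eq_conj i j h hm r
      rw [map_inv (presAdd m k), inv_inv, ← hw]
      congr 1
      -- The word w from the relation need not be compared with Artin's formulas: both words have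
      -- the same image in the braid group, where the free group embeds.
      apply freeToBraid_injective
      rw [← presHom_presFree w, hw, freeToBraid_artin]
      simp only [map_mul, map_inv, presHom_presFree, presHom_presAdd, inv_inv]
    have := hinv _ key x
    rwa [inv_inv] at this
  | h1 => simp
  | hm a b ha hb => rw [map_mul, map_mul, MulAut.mul_apply, ha, hb, map_mul]; group
  | hi a ha => exact hinv a ha x

/-- The homomorphism from the semidirect product to the presented group. -/
def presComb (m k : ℕ) :
    FreeGroup (Fin (m + k)) ⋊[(artin (m + k)).comp (presHom m k)] PureBraidPresented m k →*
      PureBraidPresented m (k + 1) :=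
  SemidirectProduct.lift (presFree m k) (presAdd m k) fun q => by
    ext1 i
    exact presFree_artin q _

theorem presHom_presComb {m k : ℕ} (g) :
    presHom m (k + 1) (presComb m k g) = combMap (presHom m k) g := by
  rw [← SemidirectProduct.inl_left_mul_inr_right g]
  simp only [map_mul, presComb, SemidirectProduct.lift_inl, SemidirectProduct.lift_inr,
    combMap_inl, combMap_inr, presHom_presFree, presHom_presAdd]

/-- A generator a_{ij} comes from the free factor if j is the last strand and from the smaller
presented group otherwise. -/
theorem presComb_surjective (m k : ℕ) : Function.Surjective (presComb m k) := by
  intro q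
  change q ∈ (presComb m k).range
  induction q using presGen_induction with
  | hs i j h hm =>
    induction i using Fin.lastCases (n := m + k) with
    | last => exact absurd h (not_lt.2 (Fin.le_last _))
    | cast i =>
      induction j using Fin.lastCases (n := m + k) with
      | last =>
        refine ⟨SemidirectProduct.inl (FreeGroup.of i), ?_⟩
        rw [presComb, SemidirectProduct.lift_inl, presFree_of]
      | cast j =>
        refine ⟨SemidirectProduct.inr (presGen i j h hm), ?_⟩
        rw [presComb, SemidirectProduct.lift_inr, presAdd_presGen]
  | h1 => exact one_mem _
  | hm x y hx hy => exact mul_mem hx hy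
  | hi x hx => exact inv_mem hx

/-- Since `presComb` is onto and its composite with `presHom` is the injective `combMap`, the map
`presHom` is injective and has the range of `combMap`. -/
theorem presHom_injective_and_range (m n : ℕ) :
    Function.Injective (presHom m n) ∧ (presHom m n).range = pureMixedBraidGroup m n := by
  induction n with
  | zero =>
    have h1 : ∀ q : PureBraidPresented m 0, q = 1 := fun q => by
      induction q using presGen_induction with
      -- There are no generators, since m ≤ j < m + 0 is impossible.
      | hs i j h hm => exact absurd j.2 (by omega)
      | h1 => rfl
      | hm x y hx hy => rw [hx, hy, one_mul]
      | hi x hx => rw [hx, inv_one]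
    refine ⟨fun x y _ => (h1 x).trans (h1 y).symm, ?_⟩
    rw [pureMixedBraidGroup_zero, eq_bot_iff]
    rintro _ ⟨q, rfl⟩
    rw [h1 q, map_one]
    exact one_mem _
  | succ k ih =>
    have hc : ⇑(presHom m (k + 1)) ∘ presComb m k = combMap (presHom m k) :=
      funext presHom_presComb
    constructor
    · refine Function.Injective.of_comp_right (g := presComb m k) ?_ (presComb_surjective m k)
      rw [hc]
      exact combMap_injective ih.1
    · rw [← range_combMap ih.2]
      apply SetLike.coe_injective
      rw [MonoidHom.coe_range, MonoidHom.coe_range, ← hc, (presComb_surjective m k).range_comp]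

/-! ### Generators, presentation and combing assembled -/

theorem closure_pureGen (m n : ℕ) :
    Subgroup.closure {g : BraidGroup (m + n) |
      ∃ i j : Fin (m + n), i < j ∧ m ≤ (j : ℕ) ∧ g = pureGen i j} =
    pureMixedBraidGroup m n := by
  rw [← (presHom_injective_and_range m n).2, MonoidHom.range_eq_map,
    ← PresentedGroup.closure_range_of, MonoidHom.map_closure]
  congr 1
  ext g
  constructor
  · rintro ⟨i, j, h, hm, rfl⟩
    exact ⟨_, ⟨⟨(i, j), h, hm⟩, rfl⟩, presHom_presGen i j h hm⟩
  · rintro ⟨_, ⟨p, rfl⟩, rfl⟩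
    exact ⟨p.1.1, p.1.2, p.2.1, p.2.2, presHom_presGen _ _ p.2.1 p.2.2⟩

end MixedBraid

theorem mainTheorem1 (m n : ℕ) :
    -- the `a_{ij}` with `i < j` and `j` not among the first `m` strands generate `P_{m,n}`
    Subgroup.closure {g : MixedBraid.BraidGroup (m + n) |
        ∃ i j : Fin (m + n), i < j ∧ m ≤ (j : ℕ) ∧ g = MixedBraid.pureGen i j} =
      MixedBraid.pureMixedBraidGroup m n ∧
    -- on these generators, the pure braid relations present `P_{m,n}`
    (∃ e : PresentedGroup (MixedBraid.pureBraidRelators m n) ≃*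
        MixedBraid.pureMixedBraidGroup m n,
      ∀ p : MixedBraid.GenIndex m n,
        (e (PresentedGroup.of p) : MixedBraid.BraidGroup (m + n)) =
          MixedBraid.pureGen p.1.1 p.1.2) ∧
    -- combing: `P_{m,0}` is trivial, and `P_{m,k+1} = F_{m+k} ⋊ P_{m,k}` for all `k < n`, where
    -- the free factor is free on the `a_{i,m+k+1}` with `i ≤ m + k` (strands counted from `1`)
    -- and `P_{m,k}` is embedded by adding a trivial last strand
    MixedBraid.pureMixedBraidGroup m 0 = ⊥ ∧
    ∀ k : ℕ, k < n →
      ∃ (φ : MixedBraid.pureMixedBraidGroup m k →* MulAut (FreeGroup (Fin (m + k))))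
        (e : FreeGroup (Fin (m + k)) ⋊[φ] MixedBraid.pureMixedBraidGroup m k ≃*
          MixedBraid.pureMixedBraidGroup m (k + 1)),
        (∀ i : Fin (m + k),
          (e (SemidirectProduct.inl (FreeGroup.of i)) : MixedBraid.BraidGroup (m + k + 1)) =
            MixedBraid.pureGen i.castSucc (Fin.last (m + k))) ∧
        ∀ g : MixedBraid.pureMixedBraidGroup m k,
          (e (SemidirectProduct.inr g) : MixedBraid.BraidGroup (m + k + 1)) =
            MixedBraid.addStrand (m + k) g := by
  refine ⟨MixedBraid.closure_pureGen m n, ?_, MixedBraid.pureMixedBraidGroup_zero m, ?_⟩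
  · obtain ⟨hi, hr⟩ := MixedBraid.presHom_injective_and_range m n
    exact ⟨(MonoidHom.ofInjective hi).trans (MulEquiv.subgroupCongr hr),
      fun p => MixedBraid.presHom_presGen _ _ p.2.1 p.2.2⟩
  · intro k _
    have hi := MixedBraid.combMap_injective (MixedBraid.pureMixedBraidGroup m k).subtype_injective
    have hr := MixedBraid.range_combMap (MixedBraid.pureMixedBraidGroup m k).range_subtype
    -- The action left to unification is Artin's action restricted to P_{m,k}.
    refine ⟨_, (MonoidHom.ofInjective hi).trans (MulEquiv.subgroupCongr hr), fun i => ?_,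
      fun g => MixedBraid.combMap_inr _ g⟩
    refine (MixedBraid.combMap_inl _ _).trans ?_
    rw [← MixedBraid.freeElt_val, MixedBraid.freeToBraid_freeElt i.2]
    rfl
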